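/- Let $N\ge 2$ and $k>0$, let $G\subset\mathbb{R}^N$ be a nonempty connected open set, and let $v$ be a real-valued classical ($C^2$) solution of $\Delta v+k^2v=0$ in $G$ which does not vanish identically in $G$. Let $\mathcal N_v=\{x\in G: v(x)=0\}$ be its nodal set and $\mathcal C_v=\{x\in G: v(x)=0,\ \nabla v(x)=0\}$ the set of its nodal critical points. A *regular portion* of $\mathcal N_v$ is a nonempty, connected, real analytic hypersurface (embedded, without boundary), relatively open in $\mathcal N_v$ and contained in $\mathcal N_v\setminus\mathcal C_v$. The *nodal domains* of $v$ are the connected components of $G\setminus\mathcal N_v$. Then the nodal domains are at most countably many, and all of them can be listed, without repetition, in a finite or infinite sequence $A_1,A_2,\ldots,A_n,\ldots$ such that for every index $j\ge 2$ of the sequence there exist an index $i$ with $1\le i<j$ and a regular portion $\Sigma_j$ of $\mathcal N_v$ such that $$\Sigma_j\subset\partial A_i\cap\partial A_j .$$ -/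

import Mathlib

namespace NodalOrder

/-- `v` is a (classical, real-valued) solution of the Helmholtz equation `Δv + k² v = 0` in the
open set `G ⊆ ℝᴺ`. Only the values of `v` on `G` matter. -/
def IsHelmholtzSolution {N : ℕ} (k : ℝ) (G : Set (EuclideanSpace ℝ (Fin N)))
    (v : EuclideanSpace ℝ (Fin N) → ℝ) : Prop :=
  ContDiffOn ℝ 2 v G ∧ ∀ x ∈ G, Laplacian.laplacian v x + k ^ 2 * v x = 0

/-- The nodal set `{x ∈ G : v x = 0}`. -/
def nodalSet {N : ℕ} (G : Set (EuclideanSpace ℝ (Fin N)))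
    (v : EuclideanSpace ℝ (Fin N) → ℝ) : Set (EuclideanSpace ℝ (Fin N)) :=
  {x | x ∈ G ∧ v x = 0}

/-- The set of nodal critical points `{x ∈ G : v x = 0 and ∇v x = 0}`. -/
def nodalCriticalSet {N : ℕ} (G : Set (EuclideanSpace ℝ (Fin N)))
    (v : EuclideanSpace ℝ (Fin N) → ℝ) : Set (EuclideanSpace ℝ (Fin N)) :=
  {x | x ∈ G ∧ v x = 0 ∧ gradient v x = 0}

/-- The nodal domains: the connected components of `{x ∈ G : v x ≠ 0}`. -/
def nodalDomains {N : ℕ} (G : Set (EuclideanSpace ℝ (Fin N)))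
    (v : EuclideanSpace ℝ (Fin N) → ℝ) : Set (Set (EuclideanSpace ℝ (Fin N))) :=
  {A | ∃ x ∈ G \ nodalSet G v, A = connectedComponentIn (G \ nodalSet G v) x}

/-- `S` is a (real) analytic hypersurface of `ℝᴺ` (embedded, without boundary): near each of its
points it is the zero set of an analytic function whose gradient does not vanish. -/
def IsAnalyticHypersurface {N : ℕ} (S : Set (EuclideanSpace ℝ (Fin N))) : Prop :=
  ∀ x ∈ S, ∃ U : Set (EuclideanSpace ℝ (Fin N)), IsOpen U ∧ x ∈ U ∧
    ∃ f : EuclideanSpace ℝ (Fin N) → ℝ, AnalyticOnNhd ℝ f U ∧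
      (∀ y ∈ U, gradient f y ≠ 0) ∧ S ∩ U = {y | y ∈ U ∧ f y = 0}

/-- `S` is a regular portion of the nodal set of `v` in `G`: a connected (in particular nonempty)
analytic hypersurface, relatively open in the nodal set, which is contained in the nodal set and
contains no nodal critical point. -/
structure IsRegularPortion {N : ℕ} (G : Set (EuclideanSpace ℝ (Fin N)))
    (v : EuclideanSpace ℝ (Fin N) → ℝ) (S : Set (EuclideanSpace ℝ (Fin N))) : Prop where
  analytic : IsAnalyticHypersurface S
  relOpen : ∃ U : Set (EuclideanSpace ℝ (Fin N)), IsOpen U ∧ S = nodalSet G v ∩ U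
  connected : IsConnected S
  subset : S ⊆ nodalSet G v \ nodalCriticalSet G v

end NodalOrder

open Set Filter Topology MeasureTheory Metric
open scoped NNReal

namespace NodalOrder

/-! The heart is a connectivity statement, `exists_adjacent_nodalDomain`: a nonempty proper family
`I` of nodal domains always has a member sharing a regular portion with a domain outside `I`. Given
this, the greedy procedure of `exists_enumeration` produces the sequence.

Suppose `I` had no such member, and let `w` be `v` on the union of `I` and `0` elsewhere. Near a
regular nodal point `v` behaves like a coordinate, so at most two nodal domains occur there; both
lie in `I` or both outside, and `w` is locally `v` or `0`. At nodal critical points `∇v` vanishes,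
which makes `∇w` locally Lipschitz across them. The derivative of a Lipschitz field vanishes almost
everywhere on the zero set of the field, so `Δw = -k² w` holds almost everywhere and hence weakly;
no bound on the size of the critical set is needed (`analyticOnNhd_indicator`). Thus `w` is
analytic. It vanishes near a point of an outside domain, hence on the connected set `G`, although it
is nonzero on the members of `I`.

Analyticity of weak solutions (`IsWeakSolution.analyticAt`) comes from adding `N` variables: `w(y)
exp(k s₁)` is harmonic in dimension `2N`, where the fundamental solution is an integer power of the
squared distance. Testing against a regularised, cut-off fundamental solution expresses `w` near the
centre by an integral whose kernel is analytic in the pole. -/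

/-- The sum of the second derivatives of `φ` along the standard basis. -/
noncomputable def coordLaplacian {N : ℕ} (φ : EuclideanSpace ℝ (Fin N) → ℝ)
    (x : EuclideanSpace ℝ (Fin N)) : ℝ :=
  ∑ i, fderiv ℝ (fun z => fderiv ℝ φ z (EuclideanSpace.single i 1)) x (EuclideanSpace.single i 1)

/-- `Δw = c w` in the sense of distributions on `B`. -/
def IsWeakSolution {N : ℕ} (c : ℝ) (B : Set (EuclideanSpace ℝ (Fin N)))
    (w : EuclideanSpace ℝ (Fin N) → ℝ) : Prop :=
  ∀ φ : EuclideanSpace ℝ (Fin N) → ℝ, ContDiff ℝ 2 φ → HasCompactSupport φ → tsupport φ ⊆ B →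
    ∫ x, w x * coordLaplacian φ x = c * ∫ x, w x * φ x

/-! ### Test functions: a cutoff times a regularised inverse power of the distance -/

section Calculus

variable {N : ℕ}

theorem contDiff_one_fderiv_apply {φ : EuclideanSpace ℝ (Fin N) → ℝ} (hφ : ContDiff ℝ 2 φ)
    (v : EuclideanSpace ℝ (Fin N)) : ContDiff ℝ 1 (fun z => fderiv ℝ φ z v) :=
  (hφ.fderiv_right (m := 1) (by norm_num)).clm_apply contDiff_const

theorem continuous_coordLaplacian {φ : EuclideanSpace ℝ (Fin N) → ℝ} (hφ : ContDiff ℝ 2 φ) :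
    Continuous (coordLaplacian φ) := by
  unfold coordLaplacian
  refine continuous_finsetSum _ fun i _ => ?_
  exact ((contDiff_one_fderiv_apply hφ _).continuous_fderiv (by norm_num)).clm_apply
    continuous_const

theorem coordLaplacian_eq_zero_of_eventuallyEq_const {φ : EuclideanSpace ℝ (Fin N) → ℝ}
    {x : EuclideanSpace ℝ (Fin N)} {c : ℝ} (h : φ =ᶠ[𝓝 x] fun _ => c) :
    coordLaplacian φ x = 0 := by
  unfold coordLaplacian
  refine Finset.sum_eq_zero fun i _ => ?_
  have : (fun z => fderiv ℝ φ z (EuclideanSpace.single i 1)) =ᶠ[𝓝 x] fun _ => (0 : ℝ) := by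
    filter_upwards [h.eventuallyEq_nhds] with z hz
    rw [hz.fderiv_eq]; simp
  rw [this.fderiv_eq]; simp

theorem coordLaplacian_mul {f g : EuclideanSpace ℝ (Fin N) → ℝ} (hf : ContDiff ℝ 2 f)
    (hg : ContDiff ℝ 2 g) (x : EuclideanSpace ℝ (Fin N)) :
    coordLaplacian (fun y => f y * g y) x = coordLaplacian f x * g x +
      2 * ∑ i, fderiv ℝ f x (EuclideanSpace.single i 1) * fderiv ℝ g x (EuclideanSpace.single i 1) +
      f x * coordLaplacian g x := by
  unfold coordLaplacian
  have hfd := hf.differentiable (by norm_num)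
  have hgd := hg.differentiable (by norm_num)
  simp only [Finset.sum_mul, Finset.mul_sum, ← Finset.sum_add_distrib]
  refine Finset.sum_congr rfl fun i _ => ?_
  have h1 : (fun z => fderiv ℝ (fun y => f y * g y) z (EuclideanSpace.single i 1)) =
      fun z => f z * fderiv ℝ g z (EuclideanSpace.single i 1) +
        g z * fderiv ℝ f z (EuclideanSpace.single i 1) := by
    funext z
    rw [fderiv_fun_mul (hfd z) (hgd z)]
    simp
  have hf' := (contDiff_one_fderiv_apply hf (EuclideanSpace.single i 1)).differentiable (by norm_num)
  have hg' := (contDiff_one_fderiv_apply hg (EuclideanSpace.single i 1)).differentiable (by norm_num)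
  rw [h1, fderiv_fun_add ((hfd x).fun_mul (hg' x)) ((hgd x).fun_mul (hf' x)),
    fderiv_fun_mul (hfd x) (hg' x), fderiv_fun_mul (hgd x) (hf' x)]
  simp
  ring

theorem hasFDerivAt_inv_pow_norm_sq_add (m : ℕ) (x y : EuclideanSpace ℝ (Fin N)) {a : ℝ}
    (ha : 0 < a) :
    HasFDerivAt (fun z => ((‖z - x‖ ^ 2 + a) ^ m)⁻¹)
      ((-(2 * m) * ((‖y - x‖ ^ 2 + a) ^ (m + 1))⁻¹) • innerSL ℝ (y - x)) y := by
  have hpos : 0 < ‖y - x‖ ^ 2 + a := by positivity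
  have h1 : HasFDerivAt (fun z => ‖z - x‖ ^ 2 + a) (2 • innerSL ℝ (y - x)) y := by
    have := ((hasFDerivAt_id y).sub_const x).norm_sq.add_const a
    simpa using this
  have h2 : HasDerivAt (fun t : ℝ => (t ^ m)⁻¹)
      (-(m * (‖y - x‖ ^ 2 + a) ^ (m - 1)) / ((‖y - x‖ ^ 2 + a) ^ m) ^ 2) (‖y - x‖ ^ 2 + a) :=
    (hasDerivAt_pow m _).fun_inv (by positivity)
  have h3 := h2.comp_hasFDerivAt y h1
  refine h3.congr_fderiv ?_
  ext v
  simp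
  rcases m with _ | m
  · simp
  · simp
    field_simp
    ring

theorem fderiv_inv_pow_norm_sq_add (m : ℕ) (x y v : EuclideanSpace ℝ (Fin N)) {a : ℝ}
    (ha : 0 < a) :
    fderiv ℝ (fun z => ((‖z - x‖ ^ 2 + a) ^ m)⁻¹) y v =
      -(2 * m) * ((‖y - x‖ ^ 2 + a) ^ (m + 1))⁻¹ * inner ℝ (y - x) v := by
  rw [(hasFDerivAt_inv_pow_norm_sq_add m x y ha).fderiv]
  rfl

theorem contDiff_inv_pow_norm_sq_add (m : ℕ) (x : EuclideanSpace ℝ (Fin N)) {a : ℝ}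
    (ha : 0 < a) :
    ContDiff ℝ 2 (fun z : EuclideanSpace ℝ (Fin N) => ((‖z - x‖ ^ 2 + a) ^ m)⁻¹) := by
  refine ContDiff.inv ?_ fun z => by positivity
  exact (((contDiff_id.sub contDiff_const).norm_sq ℝ).add contDiff_const).pow m

theorem coordLaplacian_inv_pow_norm_sq_add (m : ℕ) (x y : EuclideanSpace ℝ (Fin N)) {a : ℝ}
    (ha : 0 < a) :
    coordLaplacian (fun z => ((‖z - x‖ ^ 2 + a) ^ m)⁻¹) y =
      -(2 * m * N) * ((‖y - x‖ ^ 2 + a) ^ (m + 1))⁻¹ +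
        4 * m * (m + 1) * ‖y - x‖ ^ 2 * ((‖y - x‖ ^ 2 + a) ^ (m + 2))⁻¹ := by
  unfold coordLaplacian
  have key : ∀ i : Fin N, fderiv ℝ (fun z => fderiv ℝ (fun z => ((‖z - x‖ ^ 2 + a) ^ m)⁻¹) z
      (EuclideanSpace.single i 1)) y (EuclideanSpace.single i 1) =
      -(2 * m) * ((‖y - x‖ ^ 2 + a) ^ (m + 1))⁻¹ +
        4 * m * (m + 1) * ((‖y - x‖ ^ 2 + a) ^ (m + 2))⁻¹ * ((y - x) i) ^ 2 := by
    intro i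
    have h1 : (fun z => fderiv ℝ (fun z => ((‖z - x‖ ^ 2 + a) ^ m)⁻¹) z
        (EuclideanSpace.single i 1)) = fun z => (-(2 * m)) * (((‖z - x‖ ^ 2 + a) ^ (m + 1))⁻¹ *
          (EuclideanSpace.proj (𝕜 := ℝ) i (z - x))) := by
      funext z
      rw [fderiv_inv_pow_norm_sq_add m x z _ ha]
      simp [EuclideanSpace.inner_single_right]
      ring
    have h2 : HasFDerivAt (fun z => (EuclideanSpace.proj (𝕜 := ℝ) i (z - x)))
        (EuclideanSpace.proj i : EuclideanSpace ℝ (Fin N) →L[ℝ] ℝ) y :=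
      (EuclideanSpace.proj i : EuclideanSpace ℝ (Fin N) →L[ℝ] ℝ).hasFDerivAt.comp y
        ((hasFDerivAt_id y).sub_const x)
    have h3 := ((hasFDerivAt_inv_pow_norm_sq_add (m + 1) x y ha).fun_mul h2).const_mul (-(2 * m : ℝ))
    rw [h1, HasFDerivAt.fderiv h3]
    simp [EuclideanSpace.inner_single_right]
    ring
  have hn : ∑ i, ((y - x) i) ^ 2 = ‖y - x‖ ^ 2 := by
    rw [EuclideanSpace.norm_sq_eq]; simp
  rw [Finset.sum_congr rfl fun i _ => key i, Finset.sum_add_distrib, ← Finset.mul_sum,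
    ← Finset.mul_sum, hn, Finset.sum_const, Finset.card_univ, Fintype.card_fin, nsmul_eq_mul]
  generalize ‖y - x‖ = q
  ring

/-- The Laplacian of `f · (|· - x|² + a)⁻ᵐ`, expanded by the product rule. -/
noncomputable def testLaplacian (m : ℕ) (f : EuclideanSpace ℝ (Fin N) → ℝ)
    (x : EuclideanSpace ℝ (Fin N)) (a : ℝ) (y : EuclideanSpace ℝ (Fin N)) : ℝ :=
  coordLaplacian f y * ((‖y - x‖ ^ 2 + a) ^ m)⁻¹ -
    4 * m * fderiv ℝ f y (y - x) * ((‖y - x‖ ^ 2 + a) ^ (m + 1))⁻¹ +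
    f y * (-(2 * m * N) * ((‖y - x‖ ^ 2 + a) ^ (m + 1))⁻¹ +
        4 * m * (m + 1) * ‖y - x‖ ^ 2 * ((‖y - x‖ ^ 2 + a) ^ (m + 2))⁻¹)

theorem sum_fderiv_single_mul (f : EuclideanSpace ℝ (Fin N) → ℝ)
    (y u : EuclideanSpace ℝ (Fin N)) :
    ∑ i, fderiv ℝ f y (EuclideanSpace.single i 1) * u i = fderiv ℝ f y u := by
  have hu : u = ∑ i, u i • EuclideanSpace.single i (1 : ℝ) := by
    have := (EuclideanSpace.basisFun (Fin N) ℝ).sum_repr u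
    simpa using this.symm
  conv_rhs => rw [hu, map_sum]
  refine Finset.sum_congr rfl fun i _ => ?_
  rw [map_smul, smul_eq_mul, mul_comm]

theorem coordLaplacian_mul_inv_pow (m : ℕ) {f : EuclideanSpace ℝ (Fin N) → ℝ}
    (hf : ContDiff ℝ 2 f) (x y : EuclideanSpace ℝ (Fin N)) {a : ℝ} (ha : 0 < a) :
    coordLaplacian (fun z => f z * ((‖z - x‖ ^ 2 + a) ^ m)⁻¹) y = testLaplacian m f x a y := by
  rw [coordLaplacian_mul hf (contDiff_inv_pow_norm_sq_add m x ha),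
    coordLaplacian_inv_pow_norm_sq_add m x y ha, testLaplacian, ← sum_fderiv_single_mul]
  have hs : 2 * ∑ i, fderiv ℝ f y (EuclideanSpace.single i 1) *
      fderiv ℝ (fun z => ((‖z - x‖ ^ 2 + a) ^ m)⁻¹) y (EuclideanSpace.single i 1) =
      -(4 * m * (∑ i, fderiv ℝ f y (EuclideanSpace.single i 1) * (y - x) i) *
        ((‖y - x‖ ^ 2 + a) ^ (m + 1))⁻¹) := by
    simp only [Finset.mul_sum, Finset.sum_mul, ← Finset.sum_neg_distrib]
    refine Finset.sum_congr rfl fun i _ => ?_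
    rw [fderiv_inv_pow_norm_sq_add m x y _ ha]
    simp only [EuclideanSpace.inner_single_right, one_mul, conj_trivial]
    generalize ‖y - x‖ = q
    ring
  rw [hs, ← sub_eq_add_neg]

/-- Positivity of `a` removes the singularity, so the product is an admissible test function. With
`a = |s|² + t` this is one slice of the identity in doubled dimension. -/
theorem IsWeakSolution.integral_mul_testLaplacian {c : ℝ} {B : Set (EuclideanSpace ℝ (Fin N))}
    {w : EuclideanSpace ℝ (Fin N) → ℝ} (hw : IsWeakSolution c B w) (m : ℕ)
    {f : EuclideanSpace ℝ (Fin N) → ℝ} (hf : ContDiff ℝ 2 f) (hfc : HasCompactSupport f)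
    (hfB : tsupport f ⊆ B) (x : EuclideanSpace ℝ (Fin N)) {a : ℝ} (ha : 0 < a) :
    ∫ y, w y * testLaplacian m f x a y = c * ∫ y, w y * (f y * ((‖y - x‖ ^ 2 + a) ^ m)⁻¹) := by
  have h := hw (fun z => f z * ((‖z - x‖ ^ 2 + a) ^ m)⁻¹)
    (hf.mul (contDiff_inv_pow_norm_sq_add m x ha)) hfc.mul_right
    ((tsupport_mul_subset_left).trans hfB)
  rw [← h]
  exact integral_congr_ae (.of_forall fun y => by
    simp only [coordLaplacian_mul_inv_pow m hf x y ha])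

end Calculus

/-! ### Doubling the dimension: a weakly harmonic tensor product -/

section Product

variable {N : ℕ}

theorem continuous_testLaplacian (m : ℕ) {f : EuclideanSpace ℝ (Fin N) → ℝ}
    (hf : ContDiff ℝ 2 f) (x : EuclideanSpace ℝ (Fin N)) {X : Type*} [TopologicalSpace X]
    {a : X → ℝ} (ha : Continuous a) (ha0 : ∀ p, 0 < a p) {y : X → EuclideanSpace ℝ (Fin N)}
    (hy : Continuous y) : Continuous fun p => testLaplacian m f x (a p) (y p) := by
  have hq : ∀ j : ℕ, Continuous fun p => ((‖y p - x‖ ^ 2 + a p) ^ j)⁻¹ := fun j =>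
    ((((hy.sub continuous_const).norm.pow 2).add ha).pow j).inv₀ fun p =>
      (pow_pos (add_pos_of_nonneg_of_pos (sq_nonneg _) (ha0 p)) j).ne'
  have h1 := (continuous_coordLaplacian hf).comp hy
  have h2 : Continuous fun p => fderiv ℝ f (y p) (y p - x) :=
    ((hf.continuous_fderiv (by norm_num)).comp hy).clm_apply (hy.sub continuous_const)
  have h3 := hf.continuous.comp hy
  have h4 : Continuous fun p => ‖y p - x‖ ^ 2 := (hy.sub continuous_const).norm.pow 2
  unfold testLaplacian
  exact ((h1.mul (hq m)).sub ((continuous_const.mul h2).mul (hq _))).add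
    (h3.mul ((continuous_const.mul (hq _)).add ((continuous_const.mul h4).mul (hq _))))

theorem testLaplacian_eq_zero_of_notMem_tsupport (m : ℕ) {f : EuclideanSpace ℝ (Fin N) → ℝ}
    (x : EuclideanSpace ℝ (Fin N)) (a : ℝ) {y : EuclideanSpace ℝ (Fin N)} (hy : y ∉ tsupport f) :
    testLaplacian m f x a y = 0 := by
  have h0 : f =ᶠ[𝓝 y] fun _ => 0 := notMem_tsupport_iff_eventuallyEq.1 hy
  rw [testLaplacian, coordLaplacian_eq_zero_of_eventuallyEq_const h0, h0.fderiv_eq, h0.eq_of_nhds]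
  simp

/-- The weak form of `Δ(w ⊗ h) = 0` when `Δw = -c w` and `Δh = c h`, tested against
`η ⊗ ζ` times a regularised power of the distance to `(x, 0)`. -/
theorem integral_tensor_testLaplacian {c : ℝ} {B : Set (EuclideanSpace ℝ (Fin N))}
    {w h η ζ : EuclideanSpace ℝ (Fin N) → ℝ} (hw : IsWeakSolution (-c) B w) (hwc : Continuous w)
    (hh : IsWeakSolution c univ h) (hhc : Continuous h) (m : ℕ)
    (hη : ContDiff ℝ 2 η) (hηc : HasCompactSupport η) (hηB : tsupport η ⊆ B)
    (hζ : ContDiff ℝ 2 ζ) (hζc : HasCompactSupport ζ) (x : EuclideanSpace ℝ (Fin N)) {t : ℝ}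
    (ht : 0 < t) :
    ∫ p : EuclideanSpace ℝ (Fin N) × EuclideanSpace ℝ (Fin N),
      w p.1 * h p.2 * (ζ p.2 * testLaplacian m η x (‖p.2‖ ^ 2 + t) p.1 +
        η p.1 * testLaplacian m ζ 0 (‖p.1 - x‖ ^ 2 + t) p.2) = 0 := by
  have hK : IsCompact (tsupport η ×ˢ tsupport ζ) := hηc.isCompact.prod hζc.isCompact
  have hw1 : Continuous fun p : EuclideanSpace ℝ (Fin N) × EuclideanSpace ℝ (Fin N) => w p.1 :=
    hwc.comp continuous_fst
  have hh2 : Continuous fun p : EuclideanSpace ℝ (Fin N) × EuclideanSpace ℝ (Fin N) => h p.2 :=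
    hhc.comp continuous_snd
  have hη1 : Continuous fun p : EuclideanSpace ℝ (Fin N) × EuclideanSpace ℝ (Fin N) => η p.1 :=
    hη.continuous.comp continuous_fst
  have hζ2 : Continuous fun p : EuclideanSpace ℝ (Fin N) × EuclideanSpace ℝ (Fin N) => ζ p.2 :=
    hζ.continuous.comp continuous_snd
  have hc1 : Continuous fun p : EuclideanSpace ℝ (Fin N) × EuclideanSpace ℝ (Fin N) =>
      testLaplacian m η x (‖p.2‖ ^ 2 + t) p.1 :=
    continuous_testLaplacian m hη x (by fun_prop) (fun p => by positivity) continuous_fst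
  have hc2 : Continuous fun p : EuclideanSpace ℝ (Fin N) × EuclideanSpace ℝ (Fin N) =>
      testLaplacian m ζ 0 (‖p.1 - x‖ ^ 2 + t) p.2 :=
    continuous_testLaplacian m hζ 0 (by fun_prop) (fun p => by positivity) continuous_snd
  have hi1 : Integrable (fun p : EuclideanSpace ℝ (Fin N) × EuclideanSpace ℝ (Fin N) =>
      (h p.2 * ζ p.2) * (w p.1 * testLaplacian m η x (‖p.2‖ ^ 2 + t) p.1)) := by
    refine Continuous.integrable_of_hasCompactSupport ((hh2.mul hζ2).mul (hw1.mul hc1))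
      (HasCompactSupport.intro hK fun p hp => ?_)
    by_cases h1 : p.1 ∈ tsupport η
    · have h2 : p.2 ∉ tsupport ζ := fun h2 => hp ⟨h1, h2⟩
      simp [image_eq_zero_of_notMem_tsupport h2]
    · simp [testLaplacian_eq_zero_of_notMem_tsupport m x _ h1]
  have hi2 : Integrable (fun p : EuclideanSpace ℝ (Fin N) × EuclideanSpace ℝ (Fin N) =>
      (w p.1 * η p.1) * (h p.2 * testLaplacian m ζ 0 (‖p.1 - x‖ ^ 2 + t) p.2)) := by
    refine Continuous.integrable_of_hasCompactSupport ((hw1.mul hη1).mul (hh2.mul hc2))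
      (HasCompactSupport.intro hK fun p hp => ?_)
    by_cases h1 : p.1 ∈ tsupport η
    · have h2 : p.2 ∉ tsupport ζ := fun h2 => hp ⟨h1, h2⟩
      simp [testLaplacian_eq_zero_of_notMem_tsupport m 0 _ h2]
    · simp [image_eq_zero_of_notMem_tsupport h1]
  have hi3 : Integrable (fun p : EuclideanSpace ℝ (Fin N) × EuclideanSpace ℝ (Fin N) =>
      w p.1 * h p.2 * (η p.1 * ζ p.2) * ((‖p.1 - x‖ ^ 2 + ‖p.2‖ ^ 2 + t) ^ m)⁻¹) := by
    refine Continuous.integrable_of_hasCompactSupport ?_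
      (HasCompactSupport.intro hK fun p hp => ?_)
    · refine ((hw1.mul hh2).mul (hη1.mul hζ2)).mul (Continuous.inv₀ (by fun_prop) fun p => ?_)
      positivity
    by_cases h1 : p.1 ∈ tsupport η
    · have h2 : p.2 ∉ tsupport ζ := fun h2 => hp ⟨h1, h2⟩
      simp [image_eq_zero_of_notMem_tsupport h2]
    · simp [image_eq_zero_of_notMem_tsupport h1]
  -- For fixed `s` the equation of `w` applies with `a = |s|² + t`; for fixed `y` the equation of
  -- `h` applies with `a = |y - x|² + t`. By Fubini both reduce to the same integral, with opposite
  -- factors `-c` and `c`.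
  have e1 : ∫ p : EuclideanSpace ℝ (Fin N) × EuclideanSpace ℝ (Fin N),
      (h p.2 * ζ p.2) * (w p.1 * testLaplacian m η x (‖p.2‖ ^ 2 + t) p.1) =
      -c * ∫ p : EuclideanSpace ℝ (Fin N) × EuclideanSpace ℝ (Fin N),
        w p.1 * h p.2 * (η p.1 * ζ p.2) * ((‖p.1 - x‖ ^ 2 + ‖p.2‖ ^ 2 + t) ^ m)⁻¹ := by
    rw [Measure.volume_eq_prod, integral_prod_symm _ hi1, integral_prod_symm _ hi3,
      ← integral_const_mul]
    refine integral_congr_ae (.of_forall fun s => ?_)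
    simp only [integral_const_mul]
    rw [hw.integral_mul_testLaplacian m hη hηc hηB x (by positivity), mul_left_comm]
    congr 1
    rw [← integral_const_mul]
    refine integral_congr_ae (.of_forall fun y => ?_)
    simp only [add_assoc]
    ring
  have e2 : ∫ p : EuclideanSpace ℝ (Fin N) × EuclideanSpace ℝ (Fin N),
      (w p.1 * η p.1) * (h p.2 * testLaplacian m ζ 0 (‖p.1 - x‖ ^ 2 + t) p.2) =
      c * ∫ p : EuclideanSpace ℝ (Fin N) × EuclideanSpace ℝ (Fin N),
        w p.1 * h p.2 * (η p.1 * ζ p.2) * ((‖p.1 - x‖ ^ 2 + ‖p.2‖ ^ 2 + t) ^ m)⁻¹ := by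
    rw [Measure.volume_eq_prod, integral_prod _ hi2, integral_prod _ hi3, ← integral_const_mul]
    refine integral_congr_ae (.of_forall fun y => ?_)
    simp only [integral_const_mul]
    rw [hh.integral_mul_testLaplacian m hζ hζc (subset_univ _) 0 (by positivity), mul_left_comm]
    congr 1
    rw [← integral_const_mul]
    refine integral_congr_ae (.of_forall fun s => ?_)
    simp only [sub_zero]
    rw [← add_assoc, add_comm (‖s‖ ^ 2)]
    ring
  calc _ = ∫ p : EuclideanSpace ℝ (Fin N) × EuclideanSpace ℝ (Fin N),
        ((h p.2 * ζ p.2) * (w p.1 * testLaplacian m η x (‖p.2‖ ^ 2 + t) p.1) +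
        (w p.1 * η p.1) * (h p.2 * testLaplacian m ζ 0 (‖p.1 - x‖ ^ 2 + t) p.2)) :=
        integral_congr_ae (.of_forall fun p => by ring)
    _ = 0 := by
      rw [integral_add hi1 hi2, e1, e2]
      ring

/-- In dimension `2 (m + 1)` the function `(|y - x|² + |s|² + t)⁻ᵐ` has Laplacian
`-4 m (m + 1) t (|y - x|² + |s|² + t)⁻ᵐ⁻²`. -/
theorem tensor_testLaplacian_eq {m : ℕ} (hm : N = m + 1) (η ζ : EuclideanSpace ℝ (Fin N) → ℝ)
    (x y s : EuclideanSpace ℝ (Fin N)) {t : ℝ} (ht : 0 < t) :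
    ζ s * testLaplacian m η x (‖s‖ ^ 2 + t) y + η y * testLaplacian m ζ 0 (‖y - x‖ ^ 2 + t) s =
      (ζ s * coordLaplacian η y + η y * coordLaplacian ζ s) *
          ((‖y - x‖ ^ 2 + ‖s‖ ^ 2 + t) ^ m)⁻¹ -
        4 * m * ((ζ s * fderiv ℝ η y (y - x) + η y * fderiv ℝ ζ s s) *
          ((‖y - x‖ ^ 2 + ‖s‖ ^ 2 + t) ^ (m + 1))⁻¹) -
        4 * m * (m + 1) *
          (η y * ζ s * (t * ((‖y - x‖ ^ 2 + ‖s‖ ^ 2 + t) ^ (m + 2))⁻¹)) := by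
  have hN : (N : ℝ) = m + 1 := by rw [hm]; push_cast; ring
  have h1 : ‖y - x‖ ^ 2 + (‖s‖ ^ 2 + t) = ‖y - x‖ ^ 2 + ‖s‖ ^ 2 + t := by ring
  have h2 : ‖s - 0‖ ^ 2 + (‖y - x‖ ^ 2 + t) = ‖y - x‖ ^ 2 + ‖s‖ ^ 2 + t := by
    rw [sub_zero]; ring
  have hq : 0 < ‖y - x‖ ^ 2 + ‖s‖ ^ 2 + t := by positivity
  rw [testLaplacian, testLaplacian, h1, h2, hN, sub_zero]
  -- Replacing `|y - x|² + |s|²` by `q - t` cancels the two `q⁻ᵐ⁻¹` terms multiplying `η ζ`, because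
  -- `2N = 2(m + 1)`; only the term with the factor `t` survives.
  have h3 : ‖s‖ ^ 2 = (‖y - x‖ ^ 2 + ‖s‖ ^ 2 + t) - t - ‖y - x‖ ^ 2 := by ring
  generalize ‖y - x‖ ^ 2 + ‖s‖ ^ 2 + t = q at *
  rw [h3]
  generalize ‖y - x‖ ^ 2 = r
  generalize fderiv ℝ η y (y - x) = u
  field_simp
  ring

end Product

/-! ### The regularised Laplacian as an approximate identity -/

section Peak

variable {N : ℕ}

/-- The product space carries the sup norm while the profile uses the Euclidean one; this comparison
transfers the decay estimates. -/
theorem inv_pow_one_add_le (m : ℕ)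
    (p : EuclideanSpace ℝ (Fin N) × EuclideanSpace ℝ (Fin N)) :
    ((1 + ‖p.1‖ ^ 2 + ‖p.2‖ ^ 2) ^ (m + 2))⁻¹ ≤ ((1 + ‖p‖ ^ 2) ^ (m + 2))⁻¹ := by
  have h : ‖p‖ ^ 2 ≤ ‖p.1‖ ^ 2 + ‖p.2‖ ^ 2 := by
    rcases max_choice ‖p.1‖ ‖p.2‖ with h | h <;> rw [Prod.norm_def, h]
    · nlinarith [sq_nonneg ‖p.2‖]
    · nlinarith [sq_nonneg ‖p.1‖]
  exact inv_anti₀ (by positivity) (pow_le_pow_left₀ (by positivity) (by linarith) _)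

instance isAddHaarMeasure_volume_prod :
    (volume : Measure (EuclideanSpace ℝ (Fin N) × EuclideanSpace ℝ (Fin N))).IsAddHaarMeasure :=
  inferInstanceAs (Measure.prod volume volume).IsAddHaarMeasure

/-- The decay exponent `2(m + 2)` exceeds the dimension `2(m + 1)`. -/
theorem integrable_inv_pow_one_add {m : ℕ} (hm : N = m + 1) :
    Integrable (fun p : EuclideanSpace ℝ (Fin N) × EuclideanSpace ℝ (Fin N) =>
      ((1 + ‖p.1‖ ^ 2 + ‖p.2‖ ^ 2) ^ (m + 2))⁻¹) := by
  have hfin : (Module.finrank ℝ (EuclideanSpace ℝ (Fin N) × EuclideanSpace ℝ (Fin N)) : ℝ) <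
      2 * (m + 2 : ℕ) := by
    simp [hm]; linarith
  have h := integrable_rpow_neg_one_add_norm_sq (μ := (volume :
    Measure (EuclideanSpace ℝ (Fin N) × EuclideanSpace ℝ (Fin N)))) hfin
  refine h.mono' ?_ (.of_forall fun p => ?_)
  · refine (Continuous.inv₀ (by fun_prop) fun p => ?_).aestronglyMeasurable
    positivity
  · rw [Real.norm_of_nonneg (by positivity)]
    refine (inv_pow_one_add_le m p).trans_eq ?_
    rw [show -(2 * ((m + 2 : ℕ) : ℝ)) / 2 = -((m + 2 : ℕ) : ℝ) by ring,
      Real.rpow_neg (by positivity), Real.rpow_natCast]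

theorem integral_inv_pow_one_add_pos {m : ℕ} (hm : N = m + 1) :
    0 < ∫ p : EuclideanSpace ℝ (Fin N) × EuclideanSpace ℝ (Fin N),
      ((1 + ‖p.1‖ ^ 2 + ‖p.2‖ ^ 2) ^ (m + 2))⁻¹ := by
  rw [integral_pos_iff_support_of_nonneg (fun p => by positivity) (integrable_inv_pow_one_add hm)]
  have : Function.support (fun p : EuclideanSpace ℝ (Fin N) × EuclideanSpace ℝ (Fin N) =>
      ((1 + ‖p.1‖ ^ 2 + ‖p.2‖ ^ 2) ^ (m + 2))⁻¹) = univ := by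
    refine eq_univ_of_forall fun p => ?_
    rw [Function.mem_support]
    positivity
  rw [this]
  exact Measure.measure_univ_pos.2 (NeZero.ne _)

/-- With `t = c⁻²`, the kernel `t q⁻ᵐ⁻²` is the rescaling by `c` of the profile `(1 + |y|² +
|s|²)⁻ᵐ⁻²`: the Jacobian `c^(2m+2)` against `(c² q)⁻ᵐ⁻²` leaves `c⁻² q⁻ᵐ⁻²`. The mass therefore
concentrates at `(x, 0)`. -/
theorem tendsto_integral_peak {m : ℕ} (hm : N = m + 1) (x : EuclideanSpace ℝ (Fin N))
    {g : EuclideanSpace ℝ (Fin N) × EuclideanSpace ℝ (Fin N) → ℝ} (hg : Integrable g)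
    (hgc : ContinuousAt g (x, 0)) :
    Tendsto (fun c : ℝ => ∫ p : EuclideanSpace ℝ (Fin N) × EuclideanSpace ℝ (Fin N),
      g p * ((c ^ 2)⁻¹ * ((‖p.1 - x‖ ^ 2 + ‖p.2‖ ^ 2 + (c ^ 2)⁻¹) ^ (m + 2))⁻¹)) atTop
      (𝓝 ((∫ p : EuclideanSpace ℝ (Fin N) × EuclideanSpace ℝ (Fin N),
        ((1 + ‖p.1‖ ^ 2 + ‖p.2‖ ^ 2) ^ (m + 2))⁻¹) * g (x, 0))) := by
  set C := ∫ p : EuclideanSpace ℝ (Fin N) × EuclideanSpace ℝ (Fin N),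
        ((1 + ‖p.1‖ ^ 2 + ‖p.2‖ ^ 2) ^ (m + 2))⁻¹ with hC
  have hCpos : 0 < C := integral_inv_pow_one_add_pos hm
  have hfin : Module.finrank ℝ (EuclideanSpace ℝ (Fin N) × EuclideanSpace ℝ (Fin N)) =
      2 * (m + 1) := by
    simp [hm]; ring
  have hlim : Tendsto (fun p : EuclideanSpace ℝ (Fin N) × EuclideanSpace ℝ (Fin N) =>
      ‖p‖ ^ Module.finrank ℝ (EuclideanSpace ℝ (Fin N) × EuclideanSpace ℝ (Fin N)) *
        (C⁻¹ * ((1 + ‖p.1‖ ^ 2 + ‖p.2‖ ^ 2) ^ (m + 2))⁻¹)) (Bornology.cobounded _) (𝓝 0) := by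
    have h1 : Tendsto (fun p : EuclideanSpace ℝ (Fin N) × EuclideanSpace ℝ (Fin N) =>
        C⁻¹ * (1 + ‖p‖ ^ 2)⁻¹) (Bornology.cobounded _) (𝓝 0) := by
      have h2 : Tendsto (fun p : EuclideanSpace ℝ (Fin N) × EuclideanSpace ℝ (Fin N) =>
          1 + ‖p‖ ^ 2) (Bornology.cobounded _) atTop :=
        tendsto_atTop_add_const_left _ _
          ((tendsto_pow_atTop (by norm_num)).comp tendsto_norm_cobounded_atTop)
      simpa using (tendsto_inv_atTop_zero.comp h2).const_mul C⁻¹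
    refine squeeze_zero (fun p => by positivity) (fun p => ?_) h1
    rw [hfin, mul_left_comm]
    refine mul_le_mul_of_nonneg_left ?_ (by positivity)
    calc ‖p‖ ^ (2 * (m + 1)) * ((1 + ‖p.1‖ ^ 2 + ‖p.2‖ ^ 2) ^ (m + 2))⁻¹
        ≤ (1 + ‖p‖ ^ 2) ^ (m + 1) * ((1 + ‖p‖ ^ 2) ^ (m + 2))⁻¹ := by
          refine mul_le_mul ?_ (inv_pow_one_add_le m p) (by positivity) (by positivity)
          rw [pow_mul]
          gcongr
          linarith
      _ = (1 + ‖p‖ ^ 2)⁻¹ := by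
          have : (1 + ‖p‖ ^ 2) ≠ 0 := by positivity
          field_simp
          ring
  have h := tendsto_integral_comp_smul_smul_of_integrable' (μ := (volume :
      Measure (EuclideanSpace ℝ (Fin N) × EuclideanSpace ℝ (Fin N))))
    (φ := fun p => C⁻¹ * ((1 + ‖p.1‖ ^ 2 + ‖p.2‖ ^ 2) ^ (m + 2))⁻¹)
    (fun p => by positivity) (by rw [integral_const_mul, ← hC, inv_mul_cancel₀ hCpos.ne'])
    hlim hg hgc
  refine (h.const_mul C).congr' ?_
  filter_upwards [eventually_gt_atTop 0] with c hc
  rw [← integral_const_mul]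
  refine integral_congr_ae (.of_forall fun p => ?_)
  simp only [hfin, smul_eq_mul, Prod.smul_fst, Prod.smul_snd, Prod.fst_sub, Prod.snd_sub,
    norm_smul, Real.norm_of_nonneg hc.le, zero_sub, norm_neg]
  rw [norm_sub_rev x, show 1 + (c * ‖p.1 - x‖) ^ 2 + (c * ‖p.2‖) ^ 2 =
    c ^ 2 * (‖p.1 - x‖ ^ 2 + ‖p.2‖ ^ 2 + (c ^ 2)⁻¹) by field_simp; ring, mul_pow]
  have hq : 0 < ‖p.1 - x‖ ^ 2 + ‖p.2‖ ^ 2 + (c ^ 2)⁻¹ := by positivity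
  generalize ‖p.1 - x‖ ^ 2 + ‖p.2‖ ^ 2 + (c ^ 2)⁻¹ = q at *
  field_simp
  ring

end Peak

/-! ### Analytic dependence on the pole, in the Banach algebra `C(Y, ℝ)` -/

section Kernel

variable {N : ℕ}

/-- `(y, s) ↦ |y - x|² + |s|² + t` as a continuous function on `Y`. -/
noncomputable def sqDistMap (Y : Set (EuclideanSpace ℝ (Fin N) × EuclideanSpace ℝ (Fin N)))
    (q : EuclideanSpace ℝ (Fin N) × ℝ) : C(Y, ℝ) :=
  ⟨fun p => ‖p.1.1 - q.1‖ ^ 2 + ‖p.1.2‖ ^ 2 + q.2, by fun_prop⟩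

/-- `(y, s) ↦ b (y, s) (y - x) + a (y, s)` as a continuous function on `Y`. -/
noncomputable def affineMap (Y : Set (EuclideanSpace ℝ (Fin N) × EuclideanSpace ℝ (Fin N)))
    {b : EuclideanSpace ℝ (Fin N) × EuclideanSpace ℝ (Fin N) → EuclideanSpace ℝ (Fin N) →L[ℝ] ℝ}
    (hb : Continuous b) {a : EuclideanSpace ℝ (Fin N) × EuclideanSpace ℝ (Fin N) → ℝ}
    (ha : Continuous a) (q : EuclideanSpace ℝ (Fin N) × ℝ) : C(Y, ℝ) :=
  ⟨fun p => b p.1 (p.1.1 - q.1) + a p.1, by fun_prop⟩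

theorem analyticAt_fst_apply (i : Fin N) (q : EuclideanSpace ℝ (Fin N) × ℝ) :
    AnalyticAt ℝ (fun q : EuclideanSpace ℝ (Fin N) × ℝ => q.1 i) q :=
  ((EuclideanSpace.proj i : EuclideanSpace ℝ (Fin N) →L[ℝ] ℝ).comp
    (ContinuousLinearMap.fst ℝ _ ℝ)).analyticAt q

variable {Y : Set (EuclideanSpace ℝ (Fin N) × EuclideanSpace ℝ (Fin N))}

/-- The value `t = 0` is allowed since the pole lies off `Y`; this is what lets the regularisation
be removed without losing analyticity. -/
theorem isUnit_sqDistMap {x : EuclideanSpace ℝ (Fin N)} (hx : (x, 0) ∉ Y) {t : ℝ} (ht : 0 ≤ t) :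
    IsUnit (sqDistMap Y (x, t)) := by
  rw [ContinuousMap.isUnit_iff_forall_ne_zero]
  intro p
  have hne : 0 < ‖p.1.1 - x‖ ^ 2 + ‖p.1.2‖ ^ 2 := by
    by_contra hcon
    have h1 : ‖p.1.1 - x‖ = 0 := by nlinarith [sq_nonneg ‖p.1.1 - x‖, sq_nonneg ‖p.1.2‖]
    have h2 : ‖p.1.2‖ = 0 := by nlinarith [sq_nonneg ‖p.1.1 - x‖, sq_nonneg ‖p.1.2‖]
    refine hx ?_
    have : p.1 = (x, 0) := Prod.ext (sub_eq_zero.1 (norm_eq_zero.1 h1)) (norm_eq_zero.1 h2)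
    exact this ▸ p.2
  exact (add_pos_of_pos_of_nonneg hne ht).ne'

theorem inverse_apply_of_isUnit {f : C(Y, ℝ)} (hf : IsUnit f) (p : Y) :
    (Ring.inverse f) p = (f p)⁻¹ := by
  have h := congrArg (fun g : C(Y, ℝ) => g p) (Ring.mul_inverse_cancel f hf)
  exact eq_inv_of_mul_eq_one_right h

variable [CompactSpace Y]

theorem analyticAt_affineMap
    {b : EuclideanSpace ℝ (Fin N) × EuclideanSpace ℝ (Fin N) → EuclideanSpace ℝ (Fin N) →L[ℝ] ℝ}
    (hb : Continuous b) {a : EuclideanSpace ℝ (Fin N) × EuclideanSpace ℝ (Fin N) → ℝ}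
    (ha : Continuous a) (q : EuclideanSpace ℝ (Fin N) × ℝ) :
    AnalyticAt ℝ (affineMap Y hb ha) q := by
  let β : Fin N → C(Y, ℝ) := fun i => ⟨fun p => b p.1 (EuclideanSpace.single i 1), by fun_prop⟩
  have h : affineMap Y hb ha = fun q => affineMap Y hb ha 0 - ∑ i, q.1 i • β i := by
    funext q
    ext p
    have hsum : ∑ i, q.1 i • b p.1 (EuclideanSpace.single i 1) = b p.1 q.1 := by
      have := (EuclideanSpace.basisFun (Fin N) ℝ).sum_repr q.1
      conv_rhs => rw [← this]
      simp
    simp [affineMap, β, ContinuousMap.sum_apply] at hsum ⊢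
    rw [hsum]
    ring
  rw [h]
  exact analyticAt_const.sub (Finset.analyticAt_fun_sum _ fun i _ =>
    (analyticAt_fst_apply i q).smul analyticAt_const)

/-- Expanding the square gives a polynomial in the coordinates of `x` and in `t`, with coefficients
in `C(Y, ℝ)`. -/
theorem analyticAt_sqDistMap (q : EuclideanSpace ℝ (Fin N) × ℝ) :
    AnalyticAt ℝ (sqDistMap Y) q := by
  let β : Fin N → C(Y, ℝ) := fun i => ⟨fun p => p.1.1 i, by fun_prop⟩
  have h : sqDistMap Y = fun q => sqDistMap Y 0 +
      ∑ i, (q.1 i • (-(2 : ℝ) • β i) + (q.1 i * q.1 i) • (1 : C(Y, ℝ))) + q.2 • (1 : C(Y, ℝ)) := by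
    funext q
    ext p
    simp [sqDistMap, β, ContinuousMap.sum_apply, EuclideanSpace.norm_sq_eq, sub_sq,
      Finset.sum_add_distrib, Finset.sum_sub_distrib]
    have : ∑ i, 2 * p.1.1 i * q.1 i = ∑ i, q.1 i * (2 * p.1.1 i) :=
      Finset.sum_congr rfl fun i _ => by ring
    simp only [sq]
    linarith
  rw [h]
  refine (analyticAt_const.add (Finset.analyticAt_fun_sum _ fun i _ => ?_)).add
    (analyticAt_snd.smul analyticAt_const)
  exact ((analyticAt_fst_apply i q).smul analyticAt_const).add
    (((analyticAt_fst_apply i q).mul (analyticAt_fst_apply i q)).smul analyticAt_const)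

/-- Integration over the compact set `Y` as a continuous linear functional. -/
theorem exists_integralCLM (hY : IsCompact Y) : ∃ Λ : C(Y, ℝ) →L[ℝ] ℝ,
    ∀ (f : C(Y, ℝ)) (F : EuclideanSpace ℝ (Fin N) × EuclideanSpace ℝ (Fin N) → ℝ),
      (∀ p : Y, f p = F p) → (∀ p, p ∉ Y → F p = 0) → Λ f = ∫ p, F p := by
  let ν : Measure Y := volume.comap Subtype.val
  have : IsFiniteMeasure ν := by
    refine ⟨?_⟩
    rw [Measure.comap_apply _ Subtype.val_injective
      (fun s hs => hY.measurableSet.subtype_image hs) _ MeasurableSet.univ]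
    simpa using hY.measure_lt_top
  refine ⟨(L1.integralCLM (α := Y) (E := ℝ) (μ := ν)).comp (ContinuousMap.toLp 1 ν ℝ), fun f F hfF hF => ?_⟩
  have h1 : (L1.integralCLM (α := Y) (E := ℝ) (μ := ν)).comp (ContinuousMap.toLp 1 ν ℝ) f = ∫ p, f p ∂ν := by
    rw [ContinuousLinearMap.comp_apply]
    rw [← L1.integral_eq, L1.integral_eq_integral]
    exact integral_congr_ae (ContinuousMap.coeFn_toLp (p := 1) ν f)
  rw [h1, ← setIntegral_eq_integral_of_forall_compl_eq_zero hF,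
    ← integral_subtype_comap hY.measurableSet]
  exact integral_congr_ae (.of_forall hfF)

end Kernel

/-! ### Weyl's lemma -/

section Analyticity

variable {N : ℕ}

/-- This supplies the factor in the added variables whose eigenvalue `k²` cancels the `-k²` of `w`.
Two integrations by parts suffice, and only the direction `i₀` contributes. -/
theorem isWeakSolution_exp (k : ℝ) (i₀ : Fin N) :
    IsWeakSolution (k ^ 2) univ (fun s : EuclideanSpace ℝ (Fin N) => Real.exp (k * s i₀)) := by
  intro φ hφ hφc _
  have hexp : ∀ s : EuclideanSpace ℝ (Fin N), HasFDerivAt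
      (fun s : EuclideanSpace ℝ (Fin N) => Real.exp (k * s i₀))
      (Real.exp (k * s i₀) • k • (EuclideanSpace.proj i₀ : EuclideanSpace ℝ (Fin N) →L[ℝ] ℝ)) s := by
    intro s
    have h : HasFDerivAt (fun s : EuclideanSpace ℝ (Fin N) => k * s i₀)
        (k • (EuclideanSpace.proj i₀ : EuclideanSpace ℝ (Fin N) →L[ℝ] ℝ)) s :=
      (EuclideanSpace.proj i₀ : EuclideanSpace ℝ (Fin N) →L[ℝ] ℝ).hasFDerivAt.const_mul k
    exact h.exp
  have hcont : Continuous fun s : EuclideanSpace ℝ (Fin N) => Real.exp (k * s i₀) := by fun_prop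
  have hder : ∀ (i : Fin N) (s : EuclideanSpace ℝ (Fin N)),
      fderiv ℝ (fun s : EuclideanSpace ℝ (Fin N) => Real.exp (k * s i₀)) s
        (EuclideanSpace.single i 1) = (if i = i₀ then k else 0) * Real.exp (k * s i₀) := by
    intro i s
    rw [(hexp s).fderiv]
    by_cases h : i = i₀
    · subst h; simp [mul_comm]
    · simp [h, Ne.symm h]
  have ibp : ∀ (i : Fin N) (ψ : EuclideanSpace ℝ (Fin N) → ℝ), ContDiff ℝ 1 ψ →
      HasCompactSupport ψ → ∫ s, Real.exp (k * s i₀) * fderiv ℝ ψ s (EuclideanSpace.single i 1) =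
        -((if i = i₀ then k else 0) * ∫ s, Real.exp (k * s i₀) * ψ s) := by
    intro i ψ hψ hψc
    have hψ' : Continuous fun s => fderiv ℝ ψ s (EuclideanSpace.single i 1) :=
      (hψ.continuous_fderiv (by norm_num)).clm_apply continuous_const
    rw [integral_mul_fderiv_eq_neg_fderiv_mul_of_integrable]
    · simp only [hder, mul_assoc, integral_const_mul]
    · simp only [hder, mul_assoc]
      exact ((hcont.mul hψ.continuous).integrable_of_hasCompactSupport hψc.mul_left).const_mul _
    · exact (hcont.mul hψ').integrable_of_hasCompactSupport
        (hψc.fderiv_apply (𝕜 := ℝ) (EuclideanSpace.single i 1)).mul_left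
    · exact (hcont.mul hψ.continuous).integrable_of_hasCompactSupport hψc.mul_left
    · exact fun s _ => (hexp s).differentiableAt
    · exact fun s _ => hψ.differentiable (by norm_num) s
  have hφ' := fun i => contDiff_one_fderiv_apply hφ (EuclideanSpace.single i 1)
  have hφc' := fun i : Fin N => hφc.fderiv_apply (𝕜 := ℝ) (EuclideanSpace.single i 1)
  unfold coordLaplacian
  simp only [Finset.mul_sum]
  rw [integral_finsetSum]
  · have : ∀ i : Fin N, ∫ s, Real.exp (k * s i₀) *
        fderiv ℝ (fun z => fderiv ℝ φ z (EuclideanSpace.single i 1)) s (EuclideanSpace.single i 1) =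
        if i = i₀ then k ^ 2 * ∫ s, Real.exp (k * s i₀) * φ s else 0 := by
      intro i
      rw [ibp i _ (hφ' i) (hφc' i), ibp i _ (hφ.of_le (by norm_num)) hφc]
      split_ifs <;> ring
    rw [Finset.sum_congr rfl fun i _ => this i]
    simp
  · intro i _
    exact (hcont.mul (((hφ' i).continuous_fderiv (by norm_num)).clm_apply
      continuous_const)).integrable_of_hasCompactSupport
        ((hφc' i).fderiv_apply (𝕜 := ℝ) (EuclideanSpace.single i 1)).mul_left

theorem coordLaplacian_fderiv_eq_zero_of_eventuallyEq_const {f : EuclideanSpace ℝ (Fin N) → ℝ}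
    {y : EuclideanSpace ℝ (Fin N)} {c : ℝ} (h : f =ᶠ[𝓝 y] fun _ => c) :
    coordLaplacian f y = 0 ∧ fderiv ℝ f y = 0 :=
  ⟨coordLaplacian_eq_zero_of_eventuallyEq_const h, by rw [h.fderiv_eq]; simp⟩

/-- Weyl's lemma for the Helmholtz equation: continuous distributional solutions are analytic. -/
theorem IsWeakSolution.analyticAt (hN : 2 ≤ N) {k : ℝ} {x₀ : EuclideanSpace ℝ (Fin N)} {R : ℝ}
    (hR : 0 < R) {w : EuclideanSpace ℝ (Fin N) → ℝ} (hwc : Continuous w)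
    (hw : IsWeakSolution (-(k ^ 2)) (ball x₀ R) w) : AnalyticAt ℝ w x₀ := by
  -- The fundamental solution in dimension `2N` is a multiple of `(|y - x|² + |s|²)⁻ᵐ` with `m = N -
  -- 1`; the condition `m ≥ 1` keeps the final constant nonzero.
  obtain ⟨m, hm⟩ : ∃ m, N = m + 1 := ⟨N - 1, by omega⟩
  have hm1 : 1 ≤ m := by omega
  let i₀ : Fin N := ⟨0, by omega⟩
  let h : EuclideanSpace ℝ (Fin N) → ℝ := fun s => Real.exp (k * s i₀)
  have hhc : Continuous h := by fun_prop
  let η : ContDiffBump x₀ := ⟨R / 3, R / 2, by positivity, by linarith⟩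
  let ζ : ContDiffBump (0 : EuclideanSpace ℝ (Fin N)) := ⟨R / 3, R / 2, by positivity, by linarith⟩
  have hη : ContDiff ℝ 2 η := η.contDiff
  have hζ : ContDiff ℝ 2 ζ := ζ.contDiff
  have hηs : tsupport η = closedBall x₀ (R / 2) := η.tsupport_eq
  have hηB : tsupport η ⊆ ball x₀ R := by
    rw [hηs]; exact closedBall_subset_ball (by linarith)
  -- On the removed product of balls both cutoffs equal `1`, so terms containing their derivatives
  -- live on `Y`, away from every pole `(x, 0)` with `x` in the small ball.
  let Y : Set (EuclideanSpace ℝ (Fin N) × EuclideanSpace ℝ (Fin N)) :=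
    (tsupport η ×ˢ tsupport ζ) \ (ball x₀ (R / 3) ×ˢ ball 0 (R / 3))
  have hY : IsCompact Y :=
    (η.hasCompactSupport.isCompact.prod ζ.hasCompactSupport.isCompact).diff
      (isOpen_ball.prod isOpen_ball)
  have : CompactSpace Y := isCompact_iff_compactSpace.1 hY
  -- coefficients of the remainder, both supported in `Y`
  let α : EuclideanSpace ℝ (Fin N) × EuclideanSpace ℝ (Fin N) → ℝ := fun p =>
    ζ p.2 * coordLaplacian η p.1 + η p.1 * coordLaplacian ζ p.2
  let b : EuclideanSpace ℝ (Fin N) × EuclideanSpace ℝ (Fin N) →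
      EuclideanSpace ℝ (Fin N) →L[ℝ] ℝ := fun p => ζ p.2 • fderiv ℝ η p.1
  let a : EuclideanSpace ℝ (Fin N) × EuclideanSpace ℝ (Fin N) → ℝ := fun p =>
    η p.1 * fderiv ℝ ζ p.2 p.2
  let W : EuclideanSpace ℝ (Fin N) × EuclideanSpace ℝ (Fin N) → ℝ := fun p => w p.1 * h p.2
  have hW : Continuous W := (hwc.comp continuous_fst).mul (hhc.comp continuous_snd)
  have hη1 : Continuous fun p : EuclideanSpace ℝ (Fin N) × EuclideanSpace ℝ (Fin N) => η p.1 :=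
    hη.continuous.comp continuous_fst
  have hζ2 : Continuous fun p : EuclideanSpace ℝ (Fin N) × EuclideanSpace ℝ (Fin N) => ζ p.2 :=
    hζ.continuous.comp continuous_snd
  have hα : Continuous α :=
    (hζ2.mul ((continuous_coordLaplacian hη).comp continuous_fst)).add
      (hη1.mul ((continuous_coordLaplacian hζ).comp continuous_snd))
  have hb : Continuous b := hζ2.smul ((hη.continuous_fderiv (by norm_num)).comp continuous_fst)
  have ha : Continuous a := hη1.mul
    (((hζ.continuous_fderiv (by norm_num)).comp continuous_snd).clm_apply continuous_snd)
  have hoff : ∀ p, p ∉ Y → α p = 0 ∧ b p = 0 ∧ a p = 0 := by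
    intro p hp
    by_cases h1 : p.1 ∈ tsupport η
    · by_cases h2 : p.2 ∈ tsupport ζ
      · have h3 : p ∈ ball x₀ (R / 3) ×ˢ ball (0 : EuclideanSpace ℝ (Fin N)) (R / 3) := by
          by_contra h3
          exact hp ⟨⟨h1, h2⟩, h3⟩
        obtain ⟨e1, e2⟩ :=
          coordLaplacian_fderiv_eq_zero_of_eventuallyEq_const (η.eventuallyEq_one_of_mem_ball h3.1)
        obtain ⟨e3, e4⟩ :=
          coordLaplacian_fderiv_eq_zero_of_eventuallyEq_const (ζ.eventuallyEq_one_of_mem_ball h3.2)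
        simp [α, b, a, e1, e2, e3, e4]
      · have e := notMem_tsupport_iff_eventuallyEq.1 h2
        obtain ⟨e3, e4⟩ := coordLaplacian_fderiv_eq_zero_of_eventuallyEq_const (c := 0) e
        simp [α, b, a, e.eq_of_nhds, e3, e4]
    · have e := notMem_tsupport_iff_eventuallyEq.1 h1
      obtain ⟨e3, e4⟩ := coordLaplacian_fderiv_eq_zero_of_eventuallyEq_const (c := 0) e
      simp [α, b, a, e.eq_of_nhds, e3, e4]
  obtain ⟨Λ, hΛ⟩ := exists_integralCLM hY
  let WY : C(Y, ℝ) := ⟨fun p => W p.1, by fun_prop⟩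
  let αY : C(Y, ℝ) := ⟨fun p => α p.1, by fun_prop⟩
  let T : EuclideanSpace ℝ (Fin N) × ℝ → ℝ := fun q =>
    Λ (WY * (αY * Ring.inverse (sqDistMap Y q) ^ m -
      (4 * m : ℝ) • (affineMap Y hb ha q * Ring.inverse (sqDistMap Y q) ^ (m + 1))))
  have hxY : ∀ x ∈ ball x₀ (R / 3), (x, (0 : EuclideanSpace ℝ (Fin N))) ∉ Y := fun x hx hxY =>
    hxY.2 ⟨hx, mem_ball_self (by positivity)⟩
  -- Inversion is analytic at units of `C(Y, ℝ)`, and the squared distance is a unit even at `t =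
  -- 0`, so `T` is analytic there.
  have hT : ∀ x ∈ ball x₀ (R / 3), AnalyticAt ℝ T (x, 0) := by
    intro x hx
    have hinv : AnalyticAt ℝ (fun q => Ring.inverse (sqDistMap Y q)) (x, 0) := by
      obtain ⟨u, hu⟩ := isUnit_sqDistMap (hxY x hx) le_rfl
      have h1 := analyticAt_inverse (𝕜 := ℝ) u
      rw [hu] at h1
      exact h1.comp (analyticAt_sqDistMap (x, 0))
    refine (Λ.analyticAt _).comp (analyticAt_const.mul
      ((analyticAt_const.mul (hinv.pow m)).sub (analyticAt_const.fun_smul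
        ((analyticAt_affineMap hb ha (x, 0)).fun_mul (hinv.pow (m + 1))))))
  set C := ∫ p : EuclideanSpace ℝ (Fin N) × EuclideanSpace ℝ (Fin N),
        ((1 + ‖p.1‖ ^ 2 + ‖p.2‖ ^ 2) ^ (m + 2))⁻¹ with hC
  have hCpos : 0 < C := integral_inv_pow_one_add_pos hm
  have hgc : Continuous fun p => W p * (η p.1 * ζ p.2) := hW.mul (hη1.mul hζ2)
  have hgi : Integrable fun p => W p * (η p.1 * ζ p.2) := by
    refine hgc.integrable_of_hasCompactSupport (HasCompactSupport.intro
      (η.hasCompactSupport.isCompact.prod ζ.hasCompactSupport.isCompact) fun p hp => ?_)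
    by_cases h1 : p.1 ∈ tsupport η
    · have h2 : p.2 ∉ tsupport ζ := fun h2 => hp ⟨h1, h2⟩
      simp [image_eq_zero_of_notMem_tsupport h2]
    · simp [image_eq_zero_of_notMem_tsupport h1]
  -- Weak harmonicity balances the terms with derivatives of the cutoffs, collected in `T`, against
  -- the peak term.
  have hTt : ∀ x ∈ ball x₀ (R / 3), ∀ t : ℝ, 0 < t → T (x, t) = 4 * m * (m + 1) *
      ∫ p, W p * (η p.1 * ζ p.2) *
        (t * ((‖p.1 - x‖ ^ 2 + ‖p.2‖ ^ 2 + t) ^ (m + 2))⁻¹) := by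
    intro x hx t ht
    have hq : ∀ j : ℕ, Continuous fun p : EuclideanSpace ℝ (Fin N) × EuclideanSpace ℝ (Fin N) =>
        ((‖p.1 - x‖ ^ 2 + ‖p.2‖ ^ 2 + t) ^ j)⁻¹ := fun j =>
      Continuous.inv₀ (by fun_prop) fun p => by positivity
    let F : EuclideanSpace ℝ (Fin N) × EuclideanSpace ℝ (Fin N) → ℝ := fun p =>
      W p * (α p * ((‖p.1 - x‖ ^ 2 + ‖p.2‖ ^ 2 + t) ^ m)⁻¹ -
        4 * m * ((b p (p.1 - x) + a p) * ((‖p.1 - x‖ ^ 2 + ‖p.2‖ ^ 2 + t) ^ (m + 1))⁻¹))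
    have hF0 : ∀ p, p ∉ Y → F p = 0 := by
      intro p hp
      obtain ⟨e1, e2, e3⟩ := hoff p hp
      simp [F, e1, e2, e3]
    have hFc : Continuous F := hW.mul ((hα.mul (hq m)).sub (continuous_const.mul
      (((hb.clm_apply (continuous_fst.sub continuous_const)).add ha).mul (hq (m + 1)))))
    have hFi : Integrable F :=
      hFc.integrable_of_hasCompactSupport (HasCompactSupport.intro hY hF0)
    have hTF : T (x, t) = ∫ p, F p := by
      refine hΛ _ F (fun p => ?_) hF0
      have e1 := inverse_apply_of_isUnit (isUnit_sqDistMap (hxY x hx) ht.le) p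
      have e2 : sqDistMap Y (x, t) p = ‖p.1.1 - x‖ ^ 2 + ‖p.1.2‖ ^ 2 + t := rfl
      simp [F, WY, αY, affineMap, e1, e2]
    have hGi : Integrable fun p : EuclideanSpace ℝ (Fin N) × EuclideanSpace ℝ (Fin N) =>
        W p * (η p.1 * ζ p.2) * (t * ((‖p.1 - x‖ ^ 2 + ‖p.2‖ ^ 2 + t) ^ (m + 2))⁻¹) := by
      refine (hgc.mul (continuous_const.mul (hq (m + 2)))).integrable_of_hasCompactSupport
        (HasCompactSupport.intro
          (η.hasCompactSupport.isCompact.prod ζ.hasCompactSupport.isCompact) fun p hp => ?_)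
      by_cases h1 : p.1 ∈ tsupport η
      · have h2 : p.2 ∉ tsupport ζ := fun h2 => hp ⟨h1, h2⟩
        simp [image_eq_zero_of_notMem_tsupport h2]
      · simp [image_eq_zero_of_notMem_tsupport h1]
    have key := integral_tensor_testLaplacian hw hwc (isWeakSolution_exp k i₀) hhc m hη
      η.hasCompactSupport hηB hζ ζ.hasCompactSupport x ht
    rw [hTF, ← sub_eq_zero, ← key, ← integral_const_mul,
      ← integral_sub hFi (hGi.const_mul _)]
    refine integral_congr_ae (.of_forall fun p => ?_)
    simp only [F]
    rw [tensor_testLaplacian_eq hm η ζ x p.1 p.2 ht]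
    simp only [α, b, a, W, h, smul_apply, smul_eq_mul]
    ring
  -- Let `t = c⁻² → 0`: the peak side tends to a multiple of `w x · h 0 = w x`, the other side to `T
  -- (x, 0)` by continuity.
  have hrep : ∀ x ∈ ball x₀ (R / 3), 4 * m * (m + 1) * (C * w x) = T (x, 0) := by
    intro x hx
    have hlim := (tendsto_integral_peak hm x hgi hgc.continuousAt).const_mul
      (4 * m * (m + 1) : ℝ)
    have hinv : Tendsto (fun c : ℝ => (x, (c ^ 2)⁻¹)) atTop (𝓝 (x, (0 : ℝ))) :=
      (tendsto_const_nhds (x := x)).prodMk_nhds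
        (tendsto_inv_atTop_zero.comp (tendsto_pow_atTop (by norm_num)))
    have hlim2 := (hT x hx).continuousAt.tendsto.comp hinv
    have heq : (fun c : ℝ => 4 * m * (m + 1) * ∫ p, W p * (η p.1 * ζ p.2) *
        ((c ^ 2)⁻¹ * ((‖p.1 - x‖ ^ 2 + ‖p.2‖ ^ 2 + (c ^ 2)⁻¹) ^ (m + 2))⁻¹)) =ᶠ[atTop]
        T ∘ fun c : ℝ => (x, (c ^ 2)⁻¹) := by
      filter_upwards [eventually_gt_atTop 0] with c hc
      exact (hTt x hx _ (by positivity)).symm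
    have hu := tendsto_nhds_unique (hlim.congr' heq) hlim2
    rw [← hu]
    have e1 : η x = 1 := η.one_of_mem_closedBall (ball_subset_closedBall hx)
    have e2 : ζ (0 : EuclideanSpace ℝ (Fin N)) = 1 :=
      ζ.one_of_mem_closedBall (mem_closedBall_self (by positivity))
    simp [W, h, e1, e2, ← hC]
  have hd : (4 * m * (m + 1) * C : ℝ) ≠ 0 := by
    have : (0 : ℝ) < m := by exact_mod_cast hm1
    positivity
  have hfin : AnalyticAt ℝ (fun x => (4 * m * (m + 1) * C : ℝ)⁻¹ * T (x, 0)) x₀ :=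
    analyticAt_const.mul (AnalyticAt.comp (g := T) (f := fun x => (x, (0 : ℝ)))
      (hT x₀ (mem_ball_self (by positivity))) (analyticAt_id.prod analyticAt_const))
  refine hfin.congr ?_
  filter_upwards [ball_mem_nhds x₀ (show 0 < R / 3 by positivity)] with x hx
  rw [← hrep x hx]
  field_simp

end Analyticity

/-! ### From Lipschitz gradients to distributional solutions -/

section WeakSolutions

variable {N : ℕ}

theorem integral_mul_fderiv_of_lipschitz {K : ℝ≥0} {f ψ : EuclideanSpace ℝ (Fin N) → ℝ}
    (hf : LipschitzWith K f) (hψ : ContDiff ℝ 1 ψ) (hψc : HasCompactSupport ψ)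
    (e : EuclideanSpace ℝ (Fin N)) :
    ∫ x, f x * fderiv ℝ ψ x e = -∫ x, lineDeriv ℝ f x e * ψ x := by
  obtain ⟨D, hD⟩ := ContDiff.lipschitzWith_of_hasCompactSupport hψc hψ (by norm_num)
  rw [hf.integral_lineDeriv_mul_eq hD hψc e, ← integral_neg]
  refine integral_congr_ae (.of_forall fun x => ?_)
  simp only [(hψ.differentiable (by norm_num) x).lineDeriv_eq_fderiv, map_neg]
  ring

/-- A function with Lipschitz gradient `F` such that `div F = c f` almost everywhere on `B` is a
distributional solution of `Δ f = c f` on `B`. -/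
theorem isWeakSolution_of_lipschitz_gradient {c : ℝ} {B : Set (EuclideanSpace ℝ (Fin N))}
    {K K' : ℝ≥0} {f : EuclideanSpace ℝ (Fin N) → ℝ}
    {F : EuclideanSpace ℝ (Fin N) → EuclideanSpace ℝ (Fin N)}
    (hf : LipschitzWith K f) (hF : LipschitzWith K' F)
    (hgrad : ∀ x ∈ B, HasFDerivAt f (innerSL ℝ (F x)) x)
    (hae : ∀ᵐ x, x ∈ B → ∑ i, (fderiv ℝ F x (EuclideanSpace.single i 1)) i = c * f x) :
    IsWeakSolution c B f := by
  intro φ hφ hφc hφB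
  have hφ' := fun i => contDiff_one_fderiv_apply hφ (EuclideanSpace.single i 1)
  have hφc' := fun i : Fin N => hφc.fderiv_apply (𝕜 := ℝ) (EuclideanSpace.single i 1)
  have hFi : ∀ i : Fin N, LipschitzWith (1 * K') fun x => F x i := fun i =>
    (LipschitzWith.of_dist_le_mul fun x y => by
      rw [NNReal.coe_one, one_mul, dist_eq_norm, dist_eq_norm]
      exact PiLp.norm_apply_le (x - y) i : LipschitzWith 1 fun u : EuclideanSpace ℝ (Fin N) =>
        u i).comp hF
  have step : ∀ i : Fin N, ∫ x, f x *
      fderiv ℝ (fun z => fderiv ℝ φ z (EuclideanSpace.single i 1)) x (EuclideanSpace.single i 1) =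
      ∫ x, lineDeriv ℝ (fun x => F x i) x (EuclideanSpace.single i 1) * φ x := by
    intro i
    -- Both integrations by parts are those for Lipschitz functions. Between them the line
    -- derivative of `f` becomes the component `F i`, which is needed only on the support of `φ`.
    rw [integral_mul_fderiv_of_lipschitz hf (hφ' i) (hφc' i), ← neg_eq_iff_eq_neg.2
      (integral_mul_fderiv_of_lipschitz (hFi i) (hφ.of_le (by norm_num)) hφc _)]
    congr 1
    refine integral_congr_ae (.of_forall fun x => ?_)
    by_cases hx : x ∈ tsupport φ
    · have h := hgrad x (hφB hx)
      simp only
      rw [h.differentiableAt.lineDeriv_eq_fderiv, h.fderiv]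
      simp [EuclideanSpace.inner_single_right]
    · have h0 : φ =ᶠ[𝓝 x] fun _ => 0 := notMem_tsupport_iff_eventuallyEq.1 hx
      simp [h0.fderiv_eq]
  unfold coordLaplacian
  simp only [Finset.mul_sum]
  rw [integral_finsetSum, Finset.sum_congr rfl fun i _ => step i, ← integral_finsetSum,
    ← integral_const_mul]
  · refine integral_congr_ae ?_
    filter_upwards [hF.ae_differentiableAt (μ := volume), hae] with x hx1 hx2
    by_cases hx : x ∈ B
    · have h : ∀ i : Fin N, lineDeriv ℝ (fun x => F x i) x (EuclideanSpace.single i 1) =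
          (fderiv ℝ F x (EuclideanSpace.single i 1)) i := by
        intro i
        have hd : HasFDerivAt (fun x => F x i)
            ((EuclideanSpace.proj i : EuclideanSpace ℝ (Fin N) →L[ℝ] ℝ).comp (fderiv ℝ F x)) x :=
          (EuclideanSpace.proj i : EuclideanSpace ℝ (Fin N) →L[ℝ] ℝ).hasFDerivAt.comp x
            hx1.hasFDerivAt
        rw [hd.differentiableAt.lineDeriv_eq_fderiv, hd.fderiv]
        rfl
      rw [← Finset.sum_mul, Finset.sum_congr rfl fun i _ => h i, hx2 hx, mul_assoc]
    · have : φ x = 0 := image_eq_zero_of_notMem_tsupport fun h => hx (hφB h)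
      simp [this]
  · intro i _
    exact ((hFi i).locallyIntegrable_lineDeriv _).integrable_smul_right_of_hasCompactSupport
      hφ.continuous hφc
  · intro i _
    exact (hf.continuous.mul (((hφ' i).continuous_fderiv (by norm_num)).clm_apply
      continuous_const)).integrable_of_hasCompactSupport
        ((hφc' i).fderiv_apply (𝕜 := ℝ) (EuclideanSpace.single i 1)).mul_left

/-- On its zero set `F` is approximated by the zero map with error `0`, and at almost every point of
that set such an approximation controls the full derivative. -/
theorem ae_fderiv_eq_zero_of_eq_zero {K : ℝ≥0}
    {F : EuclideanSpace ℝ (Fin N) → EuclideanSpace ℝ (Fin N)} (hF : LipschitzWith K F) :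
    ∀ᵐ x, F x = 0 → fderiv ℝ F x = 0 := by
  set S : Set (EuclideanSpace ℝ (Fin N)) := {x | F x = 0} ∩ {x | DifferentiableAt ℝ F x} with hS
  have hSm : MeasurableSet S :=
    (isClosed_eq hF.continuous continuous_const).measurableSet.inter
      (measurableSet_of_differentiableAt ℝ F)
  have happ : ApproximatesLinearOn F (0 : EuclideanSpace ℝ (Fin N) →L[ℝ] _) S 0 := by
    intro x hx y hy
    rw [hx.1, hy.1]
    simp
  have h := happ.norm_fderiv_sub_le volume hSm (fderiv ℝ F)
    fun x hx => hx.2.hasFDerivAt.hasFDerivWithinAt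
  rw [ae_restrict_iff' hSm] at h
  filter_upwards [h, hF.ae_differentiableAt (μ := volume)] with x hx1 hx2 hx3
  have := hx1 ⟨hx3, hx2⟩
  simpa using this

/-- The vector of values of a functional on the standard basis. -/
noncomputable def coordVector :
    (EuclideanSpace ℝ (Fin N) →L[ℝ] ℝ) →L[ℝ] EuclideanSpace ℝ (Fin N) :=
  ((EuclideanSpace.equiv (Fin N) ℝ).symm : (Fin N → ℝ) →L[ℝ] EuclideanSpace ℝ (Fin N)).comp
    (ContinuousLinearMap.pi fun i => ContinuousLinearMap.apply ℝ ℝ (EuclideanSpace.single i 1))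

@[simp] theorem coordVector_apply (l : EuclideanSpace ℝ (Fin N) →L[ℝ] ℝ) (i : Fin N) :
    coordVector l i = l (EuclideanSpace.single i 1) := rfl

theorem innerSL_coordVector (l : EuclideanSpace ℝ (Fin N) →L[ℝ] ℝ) :
    innerSL ℝ (coordVector l) = l := by
  ext u
  have hu : u = ∑ i, u i • EuclideanSpace.single i (1 : ℝ) := by
    have := (EuclideanSpace.basisFun (Fin N) ℝ).sum_repr u
    simpa using this.symm
  conv_rhs => rw [hu, map_sum]
  simp [PiLp.inner_apply]

theorem sum_fderiv_coordVector_eq_laplacian {v : EuclideanSpace ℝ (Fin N) → ℝ}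
    {x : EuclideanSpace ℝ (Fin N)} (hv : ContDiffAt ℝ 2 v x) :
    ∑ i, (fderiv ℝ (fun y => coordVector (fderiv ℝ v y)) x (EuclideanSpace.single i 1)) i =
      Laplacian.laplacian v x := by
  have hd : DifferentiableAt ℝ (fderiv ℝ v) x :=
    (hv.fderiv_right (m := 1) (by norm_num)).differentiableAt (by norm_num)
  have h : HasFDerivAt (fun y => coordVector (fderiv ℝ v y))
      (coordVector.comp (fderiv ℝ (fderiv ℝ v) x)) x :=
    coordVector.hasFDerivAt.comp x hd.hasFDerivAt
  rw [h.fderiv, InnerProductSpace.laplacian_eq_iteratedFDeriv_orthonormalBasis v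
    (EuclideanSpace.basisFun (Fin N) ℝ)]
  refine Finset.sum_congr rfl fun i _ => ?_
  rw [iteratedFDeriv_two_apply]
  simp

end WeakSolutions

/-! ### Truncations of a solution are solutions -/

section Gluing

variable {N : ℕ}

/-- Let `w` be a truncation of `v` (equal to `v` on `U` and to `0` elsewhere) which, away from the
nodal critical points of `v`, locally coincides with `v` or with `0`. Then `w` is analytic. -/
theorem analyticOnNhd_indicator (hN : 2 ≤ N) {k : ℝ} {G : Set (EuclideanSpace ℝ (Fin N))}
    (hG : IsOpen G) {v : EuclideanSpace ℝ (Fin N) → ℝ} (hv : IsHelmholtzSolution k G v)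
    {U : Set (EuclideanSpace ℝ (Fin N))}
    (hloc : ∀ x ∈ G, ¬(v x = 0 ∧ fderiv ℝ v x = 0) →
      U.indicator v =ᶠ[𝓝 x] v ∨ U.indicator v =ᶠ[𝓝 x] 0) :
    AnalyticOnNhd ℝ (U.indicator v) G := by
  intro x₀ hx₀
  set w := U.indicator v with hw
  have hwv : ∀ x, |w x| ≤ |v x| := fun x => by
    by_cases hx : x ∈ U <;> simp [hw, hx]
  have hvx : ∀ x ∈ G, ContDiffAt ℝ 2 v x := fun x hx => hv.1.contDiffAt (hG.mem_nhds hx)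
  have hvd : ∀ x ∈ G, DifferentiableAt ℝ v x := fun x hx =>
    (hvx x hx).differentiableAt (by norm_num)
  set D : EuclideanSpace ℝ (Fin N) → EuclideanSpace ℝ (Fin N) := fun x =>
    coordVector (fderiv ℝ v x) with hD
  set F : EuclideanSpace ℝ (Fin N) → EuclideanSpace ℝ (Fin N) := fun x =>
    coordVector (fderiv ℝ w x) with hF
  have hDx : ∀ x ∈ G, ContDiffAt ℝ 1 D x := by
    intro x hx
    have h : ContDiffAt ℝ 1 (fderiv ℝ v) x := (hvx x hx).fderiv_right (by norm_num)
    exact (coordVector (N := N)).contDiff.contDiffAt.comp x h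
  -- Since `|w| ≤ |v|` and `v` is `o(|y - x|)` at a critical zero, so is `w`.
  have hcrit : ∀ x ∈ G, v x = 0 → fderiv ℝ v x = 0 →
      HasFDerivAt w (0 : EuclideanSpace ℝ (Fin N) →L[ℝ] ℝ) x := by
    intro x hx h0 h1
    have hd : HasFDerivAt v (0 : EuclideanSpace ℝ (Fin N) →L[ℝ] ℝ) x := h1 ▸ (hvd x hx).hasFDerivAt
    have hw0 : w x = 0 := by simpa [h0] using hwv x
    rw [hasFDerivAt_iff_isLittleO] at hd ⊢
    refine Asymptotics.IsBigO.trans_isLittleO (Asymptotics.IsBigO.of_bound 1 ?_) hd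
    refine .of_forall fun y => ?_
    simpa [hw0, h0] using hwv y
  have hwd : ∀ x ∈ G, DifferentiableAt ℝ w x := by
    intro x hx
    by_cases hc : v x = 0 ∧ fderiv ℝ v x = 0
    · exact (hcrit x hx hc.1 hc.2).differentiableAt
    · rcases hloc x hx hc with h | h
      · exact (hvd x hx).congr_of_eventuallyEq h
      · exact (differentiableAt_const (0 : ℝ)).congr_of_eventuallyEq h
  have hFD : ∀ x ∈ G, F x = D x ∨ F x = 0 := by
    intro x hx
    by_cases hc : v x = 0 ∧ fderiv ℝ v x = 0
    · right
      simp [hF, (hcrit x hx hc.1 hc.2).fderiv]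
    · rcases hloc x hx hc with h | h
      · left
        simp only [hF, hD, h.fderiv_eq]
      · right
        have : fderiv ℝ w x = 0 := by rw [h.fderiv_eq]; exact fderiv_const_apply (0 : ℝ)
        simp [hF, this]
  -- a ball on which the gradient of `v` is Lipschitz and bounded
  obtain ⟨L, t, ht, hL⟩ := (hDx x₀ hx₀).exists_lipschitzOnWith
  obtain ⟨R, hR, hRt⟩ : ∃ R > 0, ball x₀ R ⊆ t ∩ G ∩ {x | ‖D x‖₊ < ‖D x₀‖₊ + 1} := by
    refine Metric.mem_nhds_iff.1 (inter_mem (inter_mem ht (hG.mem_nhds hx₀)) ?_)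
    exact (hDx x₀ hx₀).continuousAt.nnnorm.eventually_lt continuousAt_const
      (lt_add_of_pos_right _ zero_lt_one)
  have hBG : ball x₀ R ⊆ G := fun x hx => (hRt hx).1.2
  have hLB : LipschitzOnWith L D (ball x₀ R) := hL.mono fun x hx => (hRt hx).1.1
  have hFL : LipschitzOnWith L F (ball x₀ R) := by
    refine LipschitzOnWith.of_dist_le_mul fun x hx y hy => ?_
    -- If the segment meets a critical zero `z`, both gradients are bounded by `L` times the
    -- distance to `z`, and these distances add up to `dist x y`. Otherwise connectedness of the
    -- segment forces the same alternative, `w = v` or `w = 0`, at both ends.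
    by_cases hz : ∃ z ∈ segment ℝ x y, v z = 0 ∧ fderiv ℝ v z = 0
    · obtain ⟨z, hzs, -, hz1⟩ := hz
      have hzB : z ∈ ball x₀ R := (convex_ball x₀ R).segment_subset hx hy hzs
      have hDz : D z = 0 := by simp [hD, hz1]
      have hbd : ∀ u ∈ ball x₀ R, ‖F u‖ ≤ L * dist u z := by
        intro u hu
        rcases hFD u (hBG hu) with h | h
        · have := hLB.dist_le_mul u hu z hzB
          rwa [hDz, dist_zero_right, ← h] at this
        · rw [h, norm_zero]; positivity
      calc dist (F x) (F y) ≤ ‖F x‖ + ‖F y‖ := dist_le_norm_add_norm _ _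
        _ ≤ L * dist x z + L * dist y z := add_le_add (hbd x hx) (hbd y hy)
        _ = L * dist x y := by
          rw [← dist_add_dist_of_mem_segment hzs, dist_comm y z]; ring
    · push Not at hz
      have hsub : segment ℝ x y ⊆ G := ((convex_ball x₀ R).segment_subset hx hy).trans hBG
      have hpre : IsPreconnected (segment ℝ x y) := (convex_segment x y).isPreconnected
      have hcov : segment ℝ x y ⊆ {z | w =ᶠ[𝓝 z] v} ∪ {z | w =ᶠ[𝓝 z] 0} := fun z hz' =>
        hloc z (hsub hz') fun hc => hz z hz' hc.1 hc.2
      have ho1 : IsOpen {z | w =ᶠ[𝓝 z] v} := isOpen_setOfPred_eventually_nhds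
      have ho2 : IsOpen {z | w =ᶠ[𝓝 z] 0} := isOpen_setOfPred_eventually_nhds
      have hdis : ¬(segment ℝ x y ∩ ({z | w =ᶠ[𝓝 z] v} ∩ {z | w =ᶠ[𝓝 z] 0})).Nonempty := by
        rintro ⟨z, hzs, h1, h2⟩
        have h3 : v =ᶠ[𝓝 z] fun _ => (0 : ℝ) := h1.symm.trans h2
        exact hz z hzs h3.eq_of_nhds (by rw [h3.fderiv_eq]; exact fderiv_const_apply (0 : ℝ))
      have hxs := left_mem_segment ℝ x y
      have hys := right_mem_segment ℝ x y
      have hF1 : ∀ z, w =ᶠ[𝓝 z] v → F z = D z := fun z h => by simp only [hF, hD, h.fderiv_eq]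
      have hF2 : ∀ z, w =ᶠ[𝓝 z] 0 → F z = 0 := fun z h => by
        have : fderiv ℝ w z = 0 := by rw [h.fderiv_eq]; exact fderiv_const_apply (0 : ℝ)
        simp [hF, this]
      rcases hcov hxs with h1 | h1 <;> rcases hcov hys with h2 | h2
      · rw [hF1 x h1, hF1 y h2]
        exact hLB.dist_le_mul x hx y hy
      · exact absurd (hpre _ _ ho1 ho2 hcov ⟨x, hxs, h1⟩ ⟨y, hys, h2⟩) hdis
      · exact absurd (hpre _ _ ho1 ho2 hcov ⟨y, hys, h2⟩ ⟨x, hxs, h1⟩) hdis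
      · rw [hF2 x h1, hF2 y h2, dist_self]
        positivity
  have hwL : LipschitzOnWith (‖D x₀‖₊ + 1) w (ball x₀ R) := by
    refine (convex_ball x₀ R).lipschitzOnWith_of_nnnorm_hasFDerivWithin_le
      (f' := fun x => innerSL ℝ (F x)) (fun x hx => ?_) fun x hx => ?_
    · rw [hF, innerSL_coordVector]
      exact (hwd x (hBG hx)).hasFDerivAt.hasFDerivWithinAt
    · have : ‖innerSL ℝ (F x)‖₊ = ‖F x‖₊ := NNReal.eq (innerSL_apply_norm ℝ _)
      rw [this]
      rcases hFD x (hBG hx) with h | h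
      · rw [h]; exact (hRt hx).2.le
      · rw [h, nnnorm_zero]; exact zero_le
  -- Global Lipschitz extensions are taken because the integrations by parts are over the whole
  -- space; they agree with `w` and `F` on the ball.
  obtain ⟨f₀, hf₀, hwf⟩ := hwL.extend_real
  obtain ⟨F₀, hF₀, hFF⟩ := hFL.extend_finite_dimension
  have hnear : ∀ x ∈ ball x₀ R, w =ᶠ[𝓝 x] f₀ ∧ F =ᶠ[𝓝 x] F₀ := fun x hx =>
    ⟨hwf.eventuallyEq_of_mem (isOpen_ball.mem_nhds hx),
      hFF.eventuallyEq_of_mem (isOpen_ball.mem_nhds hx)⟩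
  have hgrad : ∀ x ∈ ball x₀ R, HasFDerivAt f₀ (innerSL ℝ (F₀ x)) x := by
    intro x hx
    rw [← hFF hx, hF, innerSL_coordVector]
    exact (hwd x (hBG hx)).hasFDerivAt.congr_of_eventuallyEq (hnear x hx).1.symm
  have hae : ∀ᵐ x, x ∈ ball x₀ R →
      ∑ i, (fderiv ℝ F₀ x (EuclideanSpace.single i 1)) i = -(k ^ 2) * f₀ x := by
    -- At critical zeros both sides vanish: `F₀ = 0` there, so its derivative is zero outside a null
    -- set.
    filter_upwards [ae_fderiv_eq_zero_of_eq_zero hF₀] with x hx0 hx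
    have hxG := hBG hx
    by_cases hc : v x = 0 ∧ fderiv ℝ v x = 0
    · have h1 : F₀ x = 0 := by
        rw [← hFF hx]
        simp [hF, (hcrit x hxG hc.1 hc.2).fderiv]
      have h2 : f₀ x = 0 := by
        rw [← hwf hx]
        simpa [hc.1] using hwv x
      simp [hx0 h1, h2]
    · rcases hloc x hxG hc with h | h
      · have hFx : F₀ =ᶠ[𝓝 x] D := by
          refine (hnear x hx).2.symm.trans ?_
          filter_upwards [h.eventuallyEq_nhds] with y hy
          simp only [hF, hD, hy.fderiv_eq]
        rw [hFx.fderiv_eq, sum_fderiv_coordVector_eq_laplacian (hvx x hxG), ← hwf hx,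
          h.eq_of_nhds]
        linarith [hv.2 x hxG]
      · have hFx : F₀ =ᶠ[𝓝 x] fun _ => 0 := by
          refine (hnear x hx).2.symm.trans ?_
          filter_upwards [h.eventuallyEq_nhds] with y hy
          have : fderiv ℝ w y = 0 := by rw [hy.fderiv_eq]; exact fderiv_const_apply (0 : ℝ)
          simp [hF, this]
        rw [hFx.fderiv_eq, ← hwf hx, h.eq_of_nhds]
        simp
  have hweak := isWeakSolution_of_lipschitz_gradient hf₀ hF₀ hgrad hae
  exact (hweak.analyticAt hN hR hf₀.continuous).congr (hnear x₀ (mem_ball_self hR)).1.symm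

/-- For `U = univ` the truncation is `v` itself. -/
theorem IsHelmholtzSolution.analyticOnNhd (hN : 2 ≤ N) {k : ℝ}
    {G : Set (EuclideanSpace ℝ (Fin N))} (hG : IsOpen G) {v : EuclideanSpace ℝ (Fin N) → ℝ}
    (hv : IsHelmholtzSolution k G v) : AnalyticOnNhd ℝ v G := by
  have h := analyticOnNhd_indicator hN hG hv (U := univ) fun x _ _ => Or.inl (by simp)
  simpa using h

end Gluing

/-! ### Local structure at a regular zero -/

section LocalStructure

variable {E : Type*} [NormedAddCommGroup E] [NormedSpace ℝ E] [CompleteSpace E]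

/-- Near a zero at which its derivative does not vanish, a function looks like a coordinate. -/
theorem exists_isOpen_sign_connected {v : E → ℝ} {f' : E →L[ℝ] ℝ} {x : E}
    (hv : HasStrictFDerivAt v f' x) (hf' : f' ≠ 0) (hx : v x = 0) {s : Set E} (hs : IsOpen s)
    (hxs : x ∈ s) :
    ∃ O : Set E, IsOpen O ∧ x ∈ O ∧ O ⊆ s ∧ IsPreconnected {y | y ∈ O ∧ 0 < v y} ∧
      IsPreconnected {y | y ∈ O ∧ v y < 0} ∧ IsPreconnected {y | y ∈ O ∧ v y = 0} ∧
      ∀ y ∈ O, v y = 0 →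
        y ∈ closure {y | y ∈ O ∧ 0 < v y} ∧ y ∈ closure {y | y ∈ O ∧ v y < 0} := by
  have hrange : f'.range = ⊤ := by
    refine LinearMap.range_eq_top.2 (LinearMap.surjective fun h => hf' ?_)
    ext y
    exact congrArg (fun l : E →ₗ[ℝ] ℝ => l y) h
  let e₀ := hv.implicitToOpenPartialHomeomorph v f' hrange
  let e := e₀.restrOpen s hs
  have hxe : x ∈ e.source := ⟨hv.mem_implicitToOpenPartialHomeomorph_source hrange, hxs⟩
  have hex : e x = (0, 0) := by
    have h := hv.implicitToOpenPartialHomeomorph_self hrange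
    rw [hx] at h
    exact h
  -- The first coordinate of the implicit-function chart is `v`, so sign conditions on `v` become
  -- convex conditions on a product of balls.
  have hev : ∀ y, (e y).1 = v y := fun y => rfl
  have hvs : ∀ p ∈ e.target, v (e.symm p) = p.1 := fun p hp => by
    rw [← hev, e.right_inv hp]
  have ht : (0, 0) ∈ e.target := hex ▸ e.map_source hxe
  obtain ⟨ε, hε, hεt⟩ := Metric.mem_nhds_iff.1 (e.open_target.mem_nhds ht)
  have hball : ball ((0 : ℝ), (0 : f'.ker)) ε = ball 0 ε ×ˢ ball 0 ε :=
    (ball_prod_same _ _ _).symm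
  rw [hball] at hεt
  have himg : ∀ T : Set ℝ, {y | y ∈ e.symm '' (ball 0 ε ×ˢ ball 0 ε) ∧ v y ∈ T} =
      e.symm '' ((ball 0 ε ∩ T) ×ˢ ball 0 ε) := by
    intro T
    ext y
    constructor
    · rintro ⟨⟨p, hp, rfl⟩, hy⟩
      rw [hvs p (hεt hp)] at hy
      exact ⟨p, ⟨⟨hp.1, hy⟩, hp.2⟩, rfl⟩
    · rintro ⟨p, hp, rfl⟩
      have hp' : p ∈ ball (0 : ℝ) ε ×ˢ ball (0 : f'.ker) ε := ⟨hp.1.1, hp.2⟩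
      refine ⟨⟨p, hp', rfl⟩, ?_⟩
      rw [hvs p (hεt hp')]
      exact hp.1.2
  have hpre : ∀ T : Set ℝ, Convex ℝ T →
      IsPreconnected {y | y ∈ e.symm '' (ball 0 ε ×ˢ ball 0 ε) ∧ v y ∈ T} := by
    intro T hT
    rw [himg T]
    refine IsPreconnected.image
      (((convex_ball _ _).inter hT).prod (convex_ball _ _)).isPreconnected _ ?_
    exact e.symm.continuousOn.mono fun p hp => hεt ⟨hp.1.1, hp.2⟩
  have hcl : ∀ T : Set ℝ, (0 : ℝ) ∈ closure (ball 0 ε ∩ T) →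
      ∀ y ∈ e.symm '' (ball 0 ε ×ˢ ball 0 ε), v y = 0 →
        y ∈ closure {y | y ∈ e.symm '' (ball 0 ε ×ˢ ball 0 ε) ∧ v y ∈ T} := by
    rintro T hT _ ⟨p, hp, rfl⟩ hy
    rw [hvs p (hεt hp)] at hy
    rw [himg T]
    have hpc : p ∈ closure ((ball (0 : ℝ) ε ∩ T) ×ˢ ball (0 : f'.ker) ε) := by
      rw [closure_prod_eq]
      exact ⟨hy ▸ hT, subset_closure hp.2⟩
    exact mem_closure_image (e.symm.continuousAt (hεt hp)) hpc
  refine ⟨e.symm '' (ball 0 ε ×ˢ ball 0 ε), ?_, ?_, ?_, hpre (Ioi 0) (convex_Ioi 0),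
    hpre (Iio 0) (convex_Iio 0), hpre {0} (convex_singleton 0), fun y hy hy0 => ⟨?_, ?_⟩⟩
  · exact e.symm.isOpen_image_of_subset_source (isOpen_ball.prod isOpen_ball) hεt
  · refine ⟨(0, 0), ⟨mem_ball_self hε, mem_ball_self hε⟩, ?_⟩
    rw [← hex, e.left_inv hxe]
  · rintro _ ⟨p, hp, rfl⟩
    exact (e.map_target (hεt hp)).2
  · refine hcl (Ioi 0) ?_ y hy hy0
    rw [Real.ball_eq_Ioo, Ioo_inter_Ioi]
    simp [closure_Ioo hε.ne, hε.le]
  · refine hcl (Iio 0) ?_ y hy hy0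
    rw [Real.ball_eq_Ioo, Ioo_inter_Iio]
    have : -ε ≠ 0 := by linarith [hε.ne']
    simp [closure_Ioo this, hε.le]

end LocalStructure

/-! ### Nodal domains and their adjacency -/

section NodalDomains

variable {N : ℕ} {G : Set (EuclideanSpace ℝ (Fin N))} {v : EuclideanSpace ℝ (Fin N) → ℝ}

theorem mem_diff_nodalSet {x : EuclideanSpace ℝ (Fin N)} :
    x ∈ G \ nodalSet G v ↔ x ∈ G ∧ v x ≠ 0 :=
  ⟨fun h => ⟨h.1, fun h0 => h.2 ⟨h.1, h0⟩⟩, fun h => ⟨h.1, fun h' => h.2 h'.2⟩⟩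

theorem isOpen_diff_nodalSet (hG : IsOpen G) (hv : ContinuousOn v G) :
    IsOpen (G \ nodalSet G v) := by
  have : G \ nodalSet G v = G ∩ v ⁻¹' {0}ᶜ := by
    ext x
    rw [mem_diff_nodalSet]
    rfl
  rw [this]
  exact hv.isOpen_inter_preimage hG isOpen_compl_singleton

theorem isOpen_of_mem_nodalDomains (hG : IsOpen G) (hv : ContinuousOn v G)
    {A : Set (EuclideanSpace ℝ (Fin N))} (hA : A ∈ nodalDomains G v) : IsOpen A := by
  obtain ⟨x, -, rfl⟩ := hA
  exact (isOpen_diff_nodalSet hG hv).connectedComponentIn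

theorem subset_of_mem_nodalDomains {A : Set (EuclideanSpace ℝ (Fin N))}
    (hA : A ∈ nodalDomains G v) : A ⊆ G \ nodalSet G v := by
  obtain ⟨x, -, rfl⟩ := hA
  exact connectedComponentIn_subset _ _

theorem nonempty_of_mem_nodalDomains {A : Set (EuclideanSpace ℝ (Fin N))}
    (hA : A ∈ nodalDomains G v) : A.Nonempty := by
  obtain ⟨x, hx, rfl⟩ := hA
  exact ⟨x, mem_connectedComponentIn hx⟩

theorem eq_connectedComponentIn_of_mem_nodalDomains {A : Set (EuclideanSpace ℝ (Fin N))}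
    (hA : A ∈ nodalDomains G v) {x : EuclideanSpace ℝ (Fin N)} (hx : x ∈ A) :
    A = connectedComponentIn (G \ nodalSet G v) x := by
  obtain ⟨y, -, rfl⟩ := hA
  exact connectedComponentIn_eq hx

theorem countable_nodalDomains (hG : IsOpen G) (hv : ContinuousOn v G) :
    (nodalDomains G v).Countable := by
  refine PairwiseDisjoint.countable_of_isOpen (s := id) ?_
    (fun A hA => isOpen_of_mem_nodalDomains hG hv hA) fun A hA => nonempty_of_mem_nodalDomains hA
  intro A hA B hB hAB
  refine disjoint_left.2 fun x hxA hxB => hAB ?_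
  rw [eq_connectedComponentIn_of_mem_nodalDomains hA hxA,
    eq_connectedComponentIn_of_mem_nodalDomains hB hxB]

theorem gradient_eq_zero_iff {x : EuclideanSpace ℝ (Fin N)} :
    gradient v x = 0 ↔ fderiv ℝ v x = 0 := by
  simp [gradient]

/-- A regular nodal point lies on a regular portion separating two nodal domains. -/
theorem exists_regularPortion (hG : IsOpen G) (hv : AnalyticOnNhd ℝ v G)
    {x : EuclideanSpace ℝ (Fin N)} (hx : x ∈ G) (hx0 : v x = 0) (hx1 : fderiv ℝ v x ≠ 0) :
    ∃ O : Set (EuclideanSpace ℝ (Fin N)), IsOpen O ∧ x ∈ O ∧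
      ∃ A ∈ nodalDomains G v, ∃ B ∈ nodalDomains G v, (∀ y ∈ O, v y ≠ 0 → y ∈ A ∪ B) ∧
        ∃ S, IsRegularPortion G v S ∧ S ⊆ frontier A ∩ frontier B := by
  -- Keeping the neighbourhood inside this set makes its whole zero set free of critical points,
  -- hence a regular portion.
  have hs : IsOpen (G ∩ {y | fderiv ℝ v y ≠ 0}) :=
    hv.fderiv.continuousOn.isOpen_inter_preimage hG isOpen_compl_singleton
  obtain ⟨O, hO, hxO, hOs, hpos, hneg, hzero, hcl⟩ :=
    exists_isOpen_sign_connected (hv x hx).hasStrictFDerivAt hx1 hx0 hs ⟨hx, hx1⟩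
  -- A connected one-signed piece lies in a single nodal domain. Zeros adherent to the piece are
  -- then in the frontier of that open domain.
  have hside : ∀ P : Set (EuclideanSpace ℝ (Fin N)), IsPreconnected P →
      P ⊆ G \ nodalSet G v → P ⊆ O → (∀ y ∈ O, v y = 0 → y ∈ closure P) →
      ∃ A ∈ nodalDomains G v, P ⊆ A ∧ {y | y ∈ O ∧ v y = 0} ⊆ frontier A := by
    intro P hP hPG hPO hPc
    obtain ⟨p, hp⟩ : P.Nonempty := closure_nonempty_iff.1 ⟨x, hPc x hxO hx0⟩
    have hA : connectedComponentIn (G \ nodalSet G v) p ∈ nodalDomains G v := ⟨p, hPG hp, rfl⟩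
    have hPA := hP.subset_connectedComponentIn hp hPG
    refine ⟨_, hA, hPA, fun y hy => ?_⟩
    rw [(isOpen_of_mem_nodalDomains hG hv.continuousOn hA).frontier_eq]
    exact ⟨closure_mono hPA (hPc y hy.1 hy.2), fun h =>
      (mem_diff_nodalSet.1 (subset_of_mem_nodalDomains hA h)).2 hy.2⟩
  obtain ⟨A, hA, hPA, hSA⟩ := hside _ hpos
    (fun y hy => mem_diff_nodalSet.2 ⟨(hOs hy.1).1, hy.2.ne'⟩) (fun y hy => hy.1)
    fun y hy h => (hcl y hy h).1
  obtain ⟨B, hB, hPB, hSB⟩ := hside _ hneg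
    (fun y hy => mem_diff_nodalSet.2 ⟨(hOs hy.1).1, hy.2.ne⟩) (fun y hy => hy.1)
    fun y hy h => (hcl y hy h).2
  refine ⟨O, hO, hxO, A, hA, B, hB, fun y hy hy0 => ?_, {y | y ∈ O ∧ v y = 0}, ?_,
    subset_inter hSA hSB⟩
  · rcases hy0.lt_or_gt with h | h
    · exact Or.inr (hPB ⟨hy, h⟩)
    · exact Or.inl (hPA ⟨hy, h⟩)
  · refine ⟨fun y hy => ⟨O, hO, hy.1, v, hv.mono fun z hz => (hOs hz).1, fun z hz => ?_, ?_⟩,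
      ⟨O, hO, ?_⟩, ⟨⟨x, hxO, hx0⟩, hzero⟩, fun y hy => ⟨⟨(hOs hy.1).1, hy.2⟩, fun h => ?_⟩⟩
    · exact fun h => (hOs hz).2 (gradient_eq_zero_iff.1 h)
    · exact inter_eq_left.2 fun z hz => hz.1
    · ext z
      exact ⟨fun hz => ⟨⟨(hOs hz.1).1, hz.2⟩, hz.1⟩, fun hz => ⟨hz.2, hz.1.2⟩⟩
    · exact (hOs hy.1).2 (gradient_eq_zero_iff.1 h.2.2)

/-- Every nonempty proper family of nodal domains has a member which shares a regular portion of
the nodal set with a nodal domain outside of the family. -/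
theorem exists_adjacent_nodalDomain (hN : 2 ≤ N) {k : ℝ} (hG : IsOpen G) (hGc : IsConnected G)
    (hv : IsHelmholtzSolution k G v) {I : Set (Set (EuclideanSpace ℝ (Fin N)))}
    (hI : I ⊆ nodalDomains G v) (hIne : I.Nonempty) (hI' : (nodalDomains G v \ I).Nonempty) :
    ∃ A ∈ I, ∃ B ∈ nodalDomains G v \ I,
      ∃ S, IsRegularPortion G v S ∧ S ⊆ frontier A ∩ frontier B := by
  by_contra hcon
  have han := hv.analyticOnNhd hN hG
  have hU : ∀ A ∈ I, A ⊆ ⋃₀ I := fun A hA => subset_sUnion_of_mem hA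
  have hout : ∀ A ∈ nodalDomains G v, A ∉ I → ∀ y ∈ A, y ∉ ⋃₀ I := by
    rintro A hA hAI y hy ⟨B, hB, hyB⟩
    rw [eq_connectedComponentIn_of_mem_nodalDomains hA hy,
      ← eq_connectedComponentIn_of_mem_nodalDomains (hI hB) hyB] at hAI
    exact hAI hB
  have hw := analyticOnNhd_indicator hN hG hv (U := ⋃₀ I) fun x hx hc => by
    by_cases hx0 : v x = 0
    · obtain ⟨O, hO, hxO, A, hA, B, hB, hAB, S, hS, hSAB⟩ :=
        exists_regularPortion hG han hx hx0 fun h => hc ⟨hx0, h⟩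
      -- `A` and `B` cover the nonzero points near `x`. The mixed cases would give exactly the
      -- adjacency denied by `hcon`; in the others `w` is locally `v` or `0`.
      by_cases hAI : A ∈ I <;> by_cases hBI : B ∈ I
      · left
        filter_upwards [hO.mem_nhds hxO] with y hy
        by_cases hy0 : v y = 0
        · by_cases h : y ∈ ⋃₀ I <;> simp [h, hy0]
        · exact indicator_of_mem ((hAB y hy hy0).elim (fun h => hU A hAI h) fun h => hU B hBI h) _
      · exact absurd ⟨A, hAI, B, ⟨hB, hBI⟩, S, hS, hSAB⟩ hcon
      · exact absurd ⟨B, hBI, A, ⟨hA, hAI⟩, S, hS, inter_comm (frontier A) _ ▸ hSAB⟩ hcon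
      · right
        filter_upwards [hO.mem_nhds hxO] with y hy
        by_cases hy0 : v y = 0
        · by_cases h : y ∈ ⋃₀ I <;> simp [h, hy0]
        · exact indicator_of_notMem
            ((hAB y hy hy0).elim (fun h => hout A hA hAI y h) fun h => hout B hB hBI y h) _
    · have hxD : x ∈ G \ nodalSet G v := mem_diff_nodalSet.2 ⟨hx, hx0⟩
      have hA : connectedComponentIn (G \ nodalSet G v) x ∈ nodalDomains G v := ⟨x, hxD, rfl⟩
      have hnhds := (isOpen_of_mem_nodalDomains hG han.continuousOn hA).mem_nhds
        (mem_connectedComponentIn hxD)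
      by_cases hAI : connectedComponentIn (G \ nodalSet G v) x ∈ I
      · left
        filter_upwards [hnhds] with y hy
        exact indicator_of_mem (hU _ hAI hy) _
      · right
        filter_upwards [hnhds] with y hy
        exact indicator_of_notMem (hout _ hA hAI y hy) _
  obtain ⟨B, hB, hBI⟩ := hI'
  obtain ⟨b, hb⟩ := nonempty_of_mem_nodalDomains hB
  obtain ⟨A, hA⟩ := hIne
  obtain ⟨a, ha⟩ := nonempty_of_mem_nodalDomains (hI hA)
  have hb0 : (⋃₀ I).indicator v =ᶠ[𝓝 b] 0 := by
    filter_upwards [(isOpen_of_mem_nodalDomains hG han.continuousOn hB).mem_nhds hb] with y hy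
    exact indicator_of_notMem (hout B hB hBI y hy) _
  have haG := mem_diff_nodalSet.1 (subset_of_mem_nodalDomains (hI hA) ha)
  have hbG := mem_diff_nodalSet.1 (subset_of_mem_nodalDomains hB hb)
  -- Identity theorem on `G`: vanishing near `b` forces `w a = 0`, yet `w a = v a ≠ 0`.
  have h0 := hw.eqOn_zero_of_preconnected_of_eventuallyEq_zero hGc.isPreconnected hbG.1 hb0 haG.1
  rw [indicator_of_mem (hU A hA ha)] at h0
  exact haG.2 h0

end NodalDomains

/-! ### Greedy enumeration along an adjacency relation -/

/-- If every nonempty proper subset of a countable set is related to some element outside of it,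
the set can be enumerated so that each element but the first is related to a previous one. -/
theorem exists_enumeration {α : Type*} {S : Set α} (hS : S.Countable) (hne : S.Nonempty)
    {r : α → α → Prop}
    (H : ∀ I ⊆ S, I.Nonempty → (S \ I).Nonempty → ∃ a ∈ I, ∃ b ∈ S \ I, r a b) :
    ∃ (M : ℕ∞) (A : ℕ → α), BijOn A {j : ℕ | 1 ≤ j ∧ (j : ℕ∞) ≤ M} S ∧
      ∀ j : ℕ, 2 ≤ j → (j : ℕ∞) ≤ M → ∃ i : ℕ, 1 ≤ i ∧ i < j ∧ r (A i) (A j) := by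
  obtain ⟨e, he⟩ := countable_iff_exists_injOn.1 hS
  obtain ⟨a₀, ha₀⟩ := hne
  let cand : Set α → Set α := fun T => {b | b ∈ S \ T ∧ ∃ a ∈ T, r a b}
  -- Among the elements related to one already listed, the one of least code `e` is taken, so that
  -- none is postponed forever. The fallback `a₀` is a dummy for when there is no candidate.
  have hnext : ∀ T : Set α, ∃ b, (cand T).Nonempty → b ∈ cand T ∧ ∀ b' ∈ cand T, e b ≤ e b' := by
    intro T
    by_cases h : (cand T).Nonempty
    · obtain ⟨b, hb, hmin⟩ := exists_minimalFor_of_wellFoundedLT (· ∈ cand T) e h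
      exact ⟨b, fun _ => ⟨hb, fun b' hb' => le_of_not_gt fun hlt => hlt.not_ge (hmin hb' hlt.le)⟩⟩
    · exact ⟨a₀, fun h' => absurd h' h⟩
  choose next hnext using hnext
  let T : ℕ → Set α := fun n => Nat.rec {a₀} (fun _ T => insert (next T) T) n
  let B : ℕ → α := fun n => Nat.casesOn n a₀ fun n => next (T n)
  have hTs : ∀ n, T (n + 1) = insert (B (n + 1)) (T n) := fun n => rfl
  have hBT : ∀ n, B n ∈ T n := fun n => by
    cases n with
    | zero => exact mem_singleton _
    | succ n => exact mem_insert _ _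
  have hTmono : Monotone T := monotone_nat_of_le_succ fun n => subset_insert _ _
  have hTB : ∀ n, ∀ x ∈ T n, ∃ i ≤ n, x = B i := by
    intro n
    induction n with
    | zero => exact fun x hx => ⟨0, le_rfl, hx⟩
    | succ n ih =>
      rintro x (hx | hx)
      · exact ⟨n + 1, le_rfl, hx⟩
      · obtain ⟨i, hi, h⟩ := ih x hx
        exact ⟨i, hi.trans (Nat.le_succ n), h⟩
  have hstep : ∀ n : ℕ, T n ⊆ S → (T n).encard = n + 1 → ((n + 1 : ℕ) : ℕ∞) + 1 ≤ S.encard →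
      B (n + 1) ∈ cand (T n) ∧ ∀ b ∈ cand (T n), e (B (n + 1)) ≤ e b := by
    intro n hn hc hle
    refine hnext (T n) ?_
    have hd : (S \ T n).Nonempty := by
      rw [sdiff_nonempty]
      intro hST
      have h1 := hle.trans ((encard_le_encard hST).trans_eq hc)
      norm_cast at h1
      omega
    obtain ⟨a, ha, b, hb, hab⟩ := H (T n) hn ⟨_, hBT n⟩ hd
    exact ⟨b, hb, a, ha, hab⟩
  have hTn : ∀ n : ℕ, (n : ℕ∞) + 1 ≤ S.encard → T n ⊆ S ∧ (T n).encard = n + 1 := by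
    intro n
    induction n with
    | zero => exact fun _ => ⟨singleton_subset_iff.2 ha₀, by simp [T]⟩
    | succ n ih =>
      intro hn
      obtain ⟨h1, h2⟩ := ih (le_trans (by push_cast; exact le_self_add) hn)
      obtain ⟨h3, -⟩ := hstep n h1 h2 hn
      rw [hTs]
      refine ⟨insert_subset h3.1.1 h1, ?_⟩
      rw [encard_insert_of_notMem h3.1.2, h2]
      push_cast
      rfl
  have hcand : ∀ n : ℕ, ((n + 1 : ℕ) : ℕ∞) + 1 ≤ S.encard →
      B (n + 1) ∈ cand (T n) ∧ ∀ b ∈ cand (T n), e (B (n + 1)) ≤ e b := by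
    intro n hn
    obtain ⟨h1, h2⟩ := hTn n (le_trans (by push_cast; exact le_self_add) hn)
    exact hstep n h1 h2 hn
  have hBne : ∀ i j : ℕ, i < j → (j : ℕ∞) + 1 ≤ S.encard → B i ≠ B j := by
    intro i j hij hj h
    obtain ⟨n, rfl⟩ : ∃ n, j = n + 1 := ⟨j - 1, by omega⟩
    exact (hcand n hj).1.1.2 (h ▸ hTmono (Nat.lt_succ_iff.1 hij) (hBT i))
  have hcast : ∀ j : ℕ, 1 ≤ j → ((j : ℕ∞) ≤ S.encard ↔ ((j - 1 : ℕ) : ℕ∞) + 1 ≤ S.encard) := by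
    intro j hj
    rw [← Nat.cast_add_one, Nat.sub_add_cancel hj]
  -- `B` starts at index `0` and the required sequence at `1`; the values of `B` beyond the
  -- cardinality of `S` are irrelevant.
  refine ⟨S.encard, fun j => B (j - 1), ⟨?_, ?_, ?_⟩, ?_⟩
  · rintro j ⟨hj1, hj⟩
    exact (hTn _ ((hcast j hj1).1 hj)).1 (hBT _)
  · rintro i ⟨hi1, hi⟩ j ⟨hj1, hj⟩ h
    rcases lt_trichotomy i j with hij | hij | hij
    · exact absurd h (hBne _ _ (by omega) ((hcast j hj1).1 hj))
    · exact hij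
    · exact absurd h.symm (hBne _ _ (by omega) ((hcast i hi1).1 hi))
  · have hsuff : (∃ n : ℕ, ((n : ℕ∞) + 1 ≤ S.encard) ∧ S ⊆ T n) ∨
        (S.encard = ⊤ ∧ S ⊆ ⋃ n, T n) → SurjOn (fun j => B (j - 1))
          {j : ℕ | 1 ≤ j ∧ (j : ℕ∞) ≤ S.encard} S := by
      rintro (⟨n, hn, hST⟩ | ⟨htop, hST⟩) x hx
      · obtain ⟨i, hi, rfl⟩ := hTB n x (hST hx)
        refine ⟨i + 1, ⟨by omega, le_trans ?_ hn⟩, rfl⟩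
        exact_mod_cast Nat.succ_le_succ hi
      · obtain ⟨n, hn⟩ := mem_iUnion.1 (hST hx)
        obtain ⟨i, hi, rfl⟩ := hTB n x hn
        exact ⟨i + 1, ⟨by omega, by rw [htop]; exact le_top⟩, rfl⟩
    refine hsuff ?_
    by_cases hfin : S.Finite
    · left
      have hpos : 1 ≤ S.ncard := (ncard_pos hfin).2 ⟨a₀, ha₀⟩
      have hcard : ((S.ncard - 1 : ℕ) : ℕ∞) + 1 = S.encard := by
        rw [← Nat.cast_add_one, Nat.sub_add_cancel hpos, hfin.cast_ncard_eq]
      obtain ⟨h1, h2⟩ := hTn (S.ncard - 1) hcard.le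
      refine ⟨S.ncard - 1, hcard.le, ?_⟩
      exact ((hfin.subset h1).eq_of_subset_of_encard_le h1 (by rw [h2, hcard])).ge
    · right
      have htop : S.encard = ⊤ := encard_eq_top_iff.2 hfin
      refine ⟨htop, ?_⟩
      -- If the listed elements miss part of `S`, some missed `b` is related to a listed `a` and is
      -- a candidate at every stage from `n₀` on. Infinitely many distinct codes would then be at
      -- most `e b`.
      by_contra hST
      have hJS : (⋃ n, T n) ⊆ S := iUnion_subset fun n => (hTn n (by rw [htop]; exact le_top)).1
      obtain ⟨a, ha, b, hb, hab⟩ := H _ hJS ⟨a₀, mem_iUnion.2 ⟨0, hBT 0⟩⟩ (sdiff_nonempty.2 hST)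
      obtain ⟨n₀, hn₀⟩ := mem_iUnion.1 ha
      have hle : ∀ n, e (B (n₀ + n + 1)) ≤ e b := fun n =>
        (hcand (n₀ + n) (by rw [htop]; exact le_top)).2 b
          ⟨⟨hb.1, fun h => hb.2 (mem_iUnion.2 ⟨_, h⟩)⟩, a, hTmono (Nat.le_add_right _ _) hn₀, hab⟩
      have hinj : Function.Injective fun n => e (B (n₀ + n + 1)) := by
        intro i j hij
        have hBS : ∀ n, B n ∈ S := fun n => hJS (mem_iUnion.2 ⟨n, hBT n⟩)
        have h := he (hBS (n₀ + i + 1)) (hBS (n₀ + j + 1)) hij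
        rcases lt_trichotomy i j with hlt | hlt | hlt
        · exact absurd h (hBne (n₀ + i + 1) (n₀ + j + 1) (by omega) (by rw [htop]; exact le_top))
        · exact hlt
        · exact absurd h.symm
            (hBne (n₀ + j + 1) (n₀ + i + 1) (by omega) (by rw [htop]; exact le_top))
      exact infinite_of_injective_forall_mem hinj hle (finite_Iic (e b))
  · intro j hj2 hj
    obtain ⟨n, rfl⟩ : ∃ n, j = n + 2 := ⟨j - 2, by omega⟩
    obtain ⟨⟨-, a, ha, hab⟩, -⟩ := hcand n ((hcast (n + 2) (by omega)).1 hj)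
    obtain ⟨i, hi, rfl⟩ := hTB n a ha
    exact ⟨i + 1, by omega, by omega, hab⟩

end NodalOrder

theorem proposition3p2 (N : ℕ) (hN : 2 ≤ N) (k : ℝ) (hk : 0 < k)
    (G : Set (EuclideanSpace ℝ (Fin N))) (hGo : IsOpen G) (hGc : IsConnected G)
    (v : EuclideanSpace ℝ (Fin N) → ℝ) (hv : NodalOrder.IsHelmholtzSolution k G v)
    (hv0 : ∃ x ∈ G, v x ≠ 0) :
    ∃ (M : ℕ∞) (A : ℕ → Set (EuclideanSpace ℝ (Fin N))),
      Set.BijOn A {j : ℕ | 1 ≤ j ∧ (j : ℕ∞) ≤ M} (NodalOrder.nodalDomains G v) ∧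
      ∀ j : ℕ, 2 ≤ j → (j : ℕ∞) ≤ M →
        ∃ i : ℕ, 1 ≤ i ∧ i < j ∧
          ∃ S : Set (EuclideanSpace ℝ (Fin N)), NodalOrder.IsRegularPortion G v S ∧
            S ⊆ frontier (A i) ∩ frontier (A j) := by
  obtain ⟨x, hx, hx0⟩ := hv0
  exact NodalOrder.exists_enumeration
    (r := fun A B => ∃ S, NodalOrder.IsRegularPortion G v S ∧ S ⊆ frontier A ∩ frontier B)
    (NodalOrder.countable_nodalDomains hGo hv.1.continuousOn)
    ⟨_, x, NodalOrder.mem_diff_nodalSet.2 ⟨hx, hx0⟩, rfl⟩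
    fun I hI hIne hI' => NodalOrder.exists_adjacent_nodalDomain hN hGo hGc hv hI hIne hI'
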